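/- Let $\mathbb H$ be the skew field of real quaternions, let $\mathbf A\in\mathbb H^{m\times n}$ and $\mathbf W\in\mathbb H^{n\times m}$, and suppose that $\mathbf W\mathbf A\in\mathbb H^{n\times n}$ is Hermitian, i.e. equal to its conjugate transpose. Rank means the dimension of the right column space. For a square matrix $\mathbf B$ let $\mathrm{Ind}\,\mathbf B$ be the least integer $l\ge 0$ with $\operatorname{rank}\mathbf B^{l+1}=\operatorname{rank}\mathbf B^{l}$ (where $\mathbf B^0=\mathbf I$). Put $$k=\max\{\mathrm{Ind}(\mathbf A\mathbf W),\mathrm{Ind}(\mathbf W\mathbf A)\},\qquad r=\operatorname{rank}(\mathbf W\mathbf A)^{k+1}=\operatorname{rank}(\mathbf W\mathbf A)^{k}.$$ For a square quaternion matrix $\mathbf B=(b_{pq})$ with rows and columns indexed by a finite set $S$ of integers, and $i\in S$, the $i$-th row determinant is $$\operatorname{rdet}_i\mathbf B=\sum_{\sigma}(-1)^{|S|-c(\sigma)}\,\pi_1(\sigma)\,\pi_2(\sigma)\cdots\pi_{c(\sigma)}(\sigma),$$ where $\sigma$ runs over the permutations of $S$, $c(\sigma)$ is the number of cycles of $\sigma$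 (fixed points included), and the factor of a cycle written $(p_0\,p_1\cdots p_l)$ is the ordered product $b_{p_0p_1}b_{p_1p_2}\cdots b_{p_lp_0}$; here $\pi_1$ belongs to the cycle containing $i$, written starting from $i$, and $\pi_2,\dots,\pi_{c(\sigma)}$ belong to the other cycles, each written starting from its least element, in increasing order of these least elements. The determinant $|\mathbf B|$ of a Hermitian matrix is the common value of its row determinants (and $1$ for the empty matrix). For $\alpha\subseteq\{1,\dots,n\}$ let $\mathbf B_\alpha^\alpha$ be the principal submatrix with rows and columns in $\alpha$; let $I_{r,n}$ be the set of all $\alpha\subseteq\{1,\dots,n\}$ with $|\alpha|=r$, and $I_{r,n}\{j\}=\{\alpha\in I_{r,n}: j\in\alpha\}$. Let $\mathbf B_{j.}(\mathbf b)$ be the matrix obtained from $\mathbf B$ by replacing its $j$-th row by the row $\mathbf b$, and let $\bar{\mathbf u}_{i.}^{(k)}$ be the $i$-th row of $\mathbf A(\mathbf W\mathbf A)^k$. Then there is exactly one matrix $\mathbf X\in\mathbb H^{m\times n}$ with $$(\mathbf A\mathbf W)^{k+1}\mathbf X\mathbf W=(\mathbf A\mathbf W)^k,\qquad \mathbf X\mathbf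 W\mathbf A\mathbf W\mathbf X=\mathbf X,\qquad \mathbf A\mathbf W\mathbf X=\mathbf X\mathbf W\mathbf A,$$ namely the $\mathbf W$-weighted Drazin inverse $\mathbf A_{d,\mathbf W}=(a_{ij}^{d,\mathbf W})$ of $\mathbf A$. Moreover $\sum_{\alpha\in I_{r,n}}\bigl|\bigl((\mathbf W\mathbf A)^{k+2}\bigr)_\alpha^\alpha\bigr|\ne 0$, and for all $1\le i\le m$ and $1\le j\le n$, $$a_{ij}^{d,\mathbf W}=\frac{\displaystyle\sum_{\alpha\in I_{r,n}\{j\}}\operatorname{rdet}_j\Bigl(\bigl((\mathbf W\mathbf A)^{k+2}\bigr)_{j.}\bigl(\bar{\mathbf u}_{i.}^{(k)}\bigr)\Bigr)_\alpha^\alpha}{\displaystyle\sum_{\alpha\in I_{r,n}}\Bigl|\bigl((\mathbf W\mathbf A)^{k+2}\bigr)_\alpha^\alpha\Bigr|}.$$ -/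

import Mathlib

open scoped Quaternion

namespace QuatMat

noncomputable section

/-! ### Row determinants -/

section RowDet

variable {ι : Type*} [Fintype ι] [LinearOrder ι]

/-- The product `a_{x,σx} * a_{σx,σ²x} * ⋯ * a_{σ^{l}x,x}` along the cycle of `σ` through `x`,
started at `x` and taken from left to right; for a fixed point it is `a_{x,x}`. -/
def cycleProd (A : Matrix ι ι ℍ[ℝ]) (σ : Equiv.Perm ι) (x : ι) : ℍ[ℝ] :=
  ((List.range (Function.minimalPeriod σ x)).map
    fun t => A ((σ ^ t) x) ((σ ^ (t + 1)) x)).prod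

open Classical in
/-- The least elements of the cycles of `σ` (fixed points included) that do not contain `i`,
in increasing order. -/
def cycleLeaders (σ : Equiv.Perm ι) (i : ι) : List ι :=
  (Finset.univ.filter fun x => ¬ σ.SameCycle i x ∧ ∀ y, σ.SameCycle x y → x ≤ y).sort

/-- The `i`-th row determinant: in the term of `σ`, the cycle through `i` comes first and starts
at `i`; the other cycles follow in the order of their least elements, each started at its least
element. The sign `(-1)^(n - r)`, with `r` the number of cycles of `σ`, is the signature. -/
def rdet (i : ι) (A : Matrix ι ι ℍ[ℝ]) : ℍ[ℝ] :=
  ∑ σ : Equiv.Perm ι, (((Equiv.Perm.sign σ : ℤˣ) : ℤ) : ℍ[ℝ]) *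
    (cycleProd A σ i * ((cycleLeaders σ i).map (cycleProd A σ)).prod)

/-- The determinant of a Hermitian quaternion matrix: the common value of its row determinants,
taken along the first row. The determinant of the empty matrix is `1`. -/
def hermDet (A : Matrix ι ι ℍ[ℝ]) : ℍ[ℝ] :=
  if h : (Finset.univ : Finset ι).Nonempty then rdet (Finset.univ.min' h) A else 1

end RowDet

/-- The principal submatrix with rows and columns in `α`, in their given order. -/
def principal {n : ℕ} (A : Matrix (Fin n) (Fin n) ℍ[ℝ]) (α : Finset (Fin n)) :
    Matrix {x // x ∈ α} {x // x ∈ α} ℍ[ℝ] :=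
  A.submatrix Subtype.val Subtype.val

/-! ### Rank, index, weighted Drazin inverse -/

/-- The rank of a quaternion matrix: the dimension of its right column space. (`ℍᵐᵒᵖ` acts on
column vectors by scalar multiplication from the right.) -/
def rank {m n : ℕ} (A : Matrix (Fin m) (Fin n) ℍ[ℝ]) : ℕ :=
  Module.finrank (ℍ[ℝ])ᵐᵒᵖ
    (Submodule.span (ℍ[ℝ])ᵐᵒᵖ (Set.range fun (j : Fin n) (i : Fin m) => A i j))

/-- The index: the least `k : ℕ` with `rank A^(k+1) = rank A^k`; it is `0` exactly when `A` is
nonsingular. -/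
def ind {n : ℕ} (A : Matrix (Fin n) (Fin n) ℍ[ℝ]) : ℕ :=
  sInf {k : ℕ | rank (A ^ (k + 1)) = rank (A ^ k)}

/-- `X` satisfies the defining equations of the `W`-weighted Drazin inverse of `A`. -/
structure IsWeightedDrazin {m n : ℕ} (A : Matrix (Fin m) (Fin n) ℍ[ℝ])
    (W : Matrix (Fin n) (Fin m) ℍ[ℝ]) (X : Matrix (Fin m) (Fin n) ℍ[ℝ]) : Prop where
  pow_eq : (A * W) ^ (max (ind (A * W)) (ind (W * A)) + 1) * X * W =
    (A * W) ^ max (ind (A * W)) (ind (W * A))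
  outer : X * W * A * W * X = X
  comm : A * W * X = X * W * A

/-! ### The two sums in the determinantal representation -/

/-- The sum of the row determinants `rdet_j` of all principal submatrices of order `r` through
the index `j` of the matrix obtained from `M` by replacing its `j`-th row by `b`. -/
def rowReplacedMinorSum {n : ℕ} (r : ℕ) (M : Matrix (Fin n) (Fin n) ℍ[ℝ]) (j : Fin n)
    (b : Fin n → ℍ[ℝ]) : ℍ[ℝ] :=
  ∑ α : {α : Finset (Fin n) // α.card = r ∧ j ∈ α},
    rdet ⟨j, α.2.2⟩ (principal (M.updateRow j b) α.1)

/-- The sum of the principal minors of order `r` of a Hermitian matrix. -/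
def principalMinorSum {n : ℕ} (r : ℕ) (M : Matrix (Fin n) (Fin n) ℍ[ℝ]) : ℍ[ℝ] :=
  ∑ α ∈ Finset.powersetCard r (Finset.univ : Finset (Fin n)), hermDet (principal M α)

end

end QuatMat

/-! Write `B = W * A` and `M = B ^ (k + 2)`, which is Hermitian. The weighted Drazin inverse is `A`
times the square of the Drazin inverse of `B`, that is, `A * B ^ k * G` for any `G` that commutes
with `B` and inverts `M` on its range. The determinantal formula comes from choosing `G` among the
coefficients of the adjugate of `t + M`.

Noncommutativity is tamed by cycle reversal. Reversing one cycle of a permutation keeps the sign and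
conjugates the product along that cycle, so averaging replaces the product by its real part, which
is central and independent of the starting point (`rdet_eq_sum_re`, `sum_cycleProd_eq_sum_re`). Row
determinants of Hermitian matrices then obey the classical rules: all of them equal one real number
(`rowMinor_self`), a repeated row gives zero (`rowMinor_row_of_ne`), and expansion along the
replaced row holds.

Summing over index sets of a fixed size gives the recursion `M * C_s + C_{s+1} = d_{s+1}`, where
`d_s` is the sum of principal minors of order `s` and `C_s` is `adjCoeff s M`
(`mul_adjCoeff_add_adjCoeff_succ`). Let `q` be the largest order with `d_q ≠ 0`. The recursion and
`C_n = 0` force `M * C_q = 0`, and `G = C_{q-1} / d_q` satisfies `C_q = d_q (1 - M * G)`. So `1 - M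
* G` projects onto the kernel of `M`; its trace shows that `q` is the rank of `M`, which is `r`. The
entries of `A * B ^ k * G` are the asserted quotients by the expansion along row `j`. -/

namespace QuatMat

/-! ### Products along cycles -/

section Cycles

set_option linter.unusedSectionVars false

variable {ι : Type*} [Fintype ι] [LinearOrder ι]

open Equiv Equiv.Perm

theorem pow_apply_eq_of_agree {σ τ : Perm ι} {x : ι} (h : ∀ z, σ.SameCycle x z → τ z = σ z)
    (t : ℕ) : (τ ^ t) x = (σ ^ t) x := by
  induction t with
  | zero => rfl
  | succ t ih =>
    rw [pow_succ', pow_succ', Perm.mul_apply, Perm.mul_apply, ih]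
    exact h _ ((sameCycle_pow_right).2 (SameCycle.refl _ _))

theorem sameCycle_iff_of_agree {σ τ : Perm ι} {x : ι} (h : ∀ z, σ.SameCycle x z → τ z = σ z)
    (y : ι) : τ.SameCycle x y ↔ σ.SameCycle x y := by
  constructor
  · intro hy
    obtain ⟨t, rfl⟩ := hy.exists_nat_pow_eq
    rw [pow_apply_eq_of_agree h]
    exact (sameCycle_pow_right).2 (SameCycle.refl _ _)
  · intro hy
    obtain ⟨t, rfl⟩ := hy.exists_nat_pow_eq
    rw [← pow_apply_eq_of_agree h]
    exact (sameCycle_pow_right).2 (SameCycle.refl _ _)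

theorem minimalPeriod_pos (σ : Perm ι) (x : ι) : 0 < Function.minimalPeriod σ x := by
  refine Function.IsPeriodicPt.minimalPeriod_pos (orderOf_pos σ) ?_
  rw [Function.IsPeriodicPt, Function.IsFixedPt, ← Perm.coe_pow, pow_orderOf_eq_one]
  rfl

theorem pow_minimalPeriod_apply (σ : Perm ι) (x : ι) :
    (σ ^ Function.minimalPeriod σ x) x = x := by
  rw [Perm.coe_pow]
  exact Function.iterate_minimalPeriod

theorem pow_apply_ne_of_lt_minimalPeriod {σ : Perm ι} {x : ι} {t : ℕ} (h0 : 0 < t)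
    (ht : t < Function.minimalPeriod σ x) : (σ ^ t) x ≠ x := by
  rw [Perm.coe_pow]
  exact Function.not_isPeriodicPt_of_pos_of_lt_minimalPeriod h0.ne' ht

theorem minimalPeriod_eq_of_first_return {σ : Perm ι} {x : ι} {N : ℕ} (h0 : 0 < N)
    (hN : (σ ^ N) x = x) (hlt : ∀ t, 0 < t → t < N → (σ ^ t) x ≠ x) :
    Function.minimalPeriod σ x = N := by
  refine le_antisymm (Function.IsPeriodicPt.minimalPeriod_le h0 ?_) ?_
  · rw [Function.IsPeriodicPt, Function.IsFixedPt, ← Perm.coe_pow, hN]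
  · by_contra! hc
    exact hlt _ (minimalPeriod_pos σ x) hc (pow_minimalPeriod_apply σ x)

theorem minimalPeriod_eq_of_agree {σ τ : Perm ι} {x : ι}
    (h : ∀ z, σ.SameCycle x z → τ z = σ z) :
    Function.minimalPeriod τ x = Function.minimalPeriod σ x := by
  refine minimalPeriod_eq_of_first_return (minimalPeriod_pos σ x) ?_ ?_
  · rw [pow_apply_eq_of_agree h, pow_minimalPeriod_apply]
  · intro t h0 ht
    rw [pow_apply_eq_of_agree h]
    exact pow_apply_ne_of_lt_minimalPeriod h0 ht

theorem cycleProd_congr {A B : Matrix ι ι ℍ[ℝ]} {σ τ : Perm ι} {x : ι}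
    (h : ∀ z, σ.SameCycle x z → τ z = σ z)
    (hAB : ∀ z w, σ.SameCycle x z → σ.SameCycle x w → A z w = B z w) :
    cycleProd A τ x = cycleProd B σ x := by
  unfold cycleProd
  rw [minimalPeriod_eq_of_agree h]
  congr 1
  refine List.map_congr_left fun t _ => ?_
  rw [pow_apply_eq_of_agree h, pow_apply_eq_of_agree h]
  exact hAB _ _ ((sameCycle_pow_right).2 (SameCycle.refl _ _))
    ((sameCycle_pow_right).2 (SameCycle.refl _ _))

theorem minimalPeriod_inv (σ : Perm ι) (x : ι) :
    Function.minimalPeriod (σ⁻¹ : Perm ι) x = Function.minimalPeriod σ x := by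
  have key : ∀ t, (σ⁻¹ ^ t) x = x ↔ (σ ^ t) x = x := fun t => by
    rw [inv_pow, Perm.inv_eq_iff_eq, eq_comm]
  refine minimalPeriod_eq_of_first_return (minimalPeriod_pos σ x) ?_ ?_
  · rw [key, pow_minimalPeriod_apply]
  · intro t h0 ht
    rw [Ne, key]
    exact pow_apply_ne_of_lt_minimalPeriod h0 ht

/-- Conjugation reverses the order of the factors and, by the Hermitian symmetry on this cycle,
swaps the indices of each: the same closed path is run backwards from `x`. -/
theorem cycleProd_inv {A : Matrix ι ι ℍ[ℝ]} {σ : Perm ι} {x : ι}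
    (hA : ∀ z w, σ.SameCycle x z → σ.SameCycle x w → star (A z w) = A w z) :
    cycleProd A σ⁻¹ x = star (cycleProd A σ x) := by
  have hs : ∀ t : ℕ, σ.SameCycle x ((σ ^ t) x) := fun t =>
    (sameCycle_pow_right).2 (SameCycle.refl _ _)
  have hstar : ∀ l : List ℍ[ℝ], star l.prod = (l.map star).reverse.prod := by
    intro l
    induction l with
    | nil => simp
    | cons a l ih => simp [ih]
  unfold cycleProd
  rw [minimalPeriod_inv, hstar, List.map_map]
  congr 1
  refine List.ext_getElem (by simp) fun t h1 h2 => ?_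
  simp only [List.length_map, List.length_range] at h1
  simp only [List.getElem_map, List.getElem_range, List.getElem_reverse, List.length_map,
    List.length_range, Function.comp]
  rw [hA _ _ (hs _) (hs _)]
  have key : ∀ s, s ≤ Function.minimalPeriod σ x →
      (σ⁻¹ ^ s) x = (σ ^ (Function.minimalPeriod σ x - s)) x := by
    intro s hs
    rw [inv_pow, Perm.inv_eq_iff_eq, ← Perm.mul_apply, ← pow_add, Nat.add_sub_cancel' hs,
      pow_minimalPeriod_apply]
  rw [key _ h1.le, key _ h1,
    show Function.minimalPeriod σ x - 1 - t = Function.minimalPeriod σ x - (t + 1) by omega,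
    show Function.minimalPeriod σ x - (t + 1) + 1 = Function.minimalPeriod σ x - t by omega]

/-- Moving the starting point rotates the product cyclically, and `Re (ab) = Re (ba)`. -/
theorem re_cycleProd_apply (A : Matrix ι ι ℍ[ℝ]) (σ : Perm ι) (x : ι) :
    (cycleProd A σ (σ x)).re = (cycleProd A σ x).re := by
  have hp : Function.minimalPeriod σ (σ x) = Function.minimalPeriod σ x :=
    Function.minimalPeriod_apply
      (Function.minimalPeriod_pos_iff_mem_periodicPts.1 (minimalPeriod_pos σ x))
  have hcomm : ∀ a b : ℍ[ℝ], (a * b).re = (b * a).re := fun a b => by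
    simp only [Quaternion.re_mul]; ring
  obtain ⟨p, hp'⟩ := Nat.exists_eq_succ_of_ne_zero (minimalPeriod_pos σ x).ne'
  have hx : (σ ^ (p + 1)) x = x := by
    have := pow_minimalPeriod_apply σ x
    rwa [hp'] at this
  unfold cycleProd
  rw [hp, hp', List.range_succ, List.map_append, List.prod_append, hcomm,
    ← List.range_succ, List.range_succ_eq_map]
  simp only [List.map_cons, List.map_nil, List.prod_cons, List.prod_nil, List.map_map, mul_one]
  have h1 : ∀ t, (σ ^ t) (σ x) = (σ ^ (t + 1)) x := fun t => by
    rw [pow_succ, Perm.mul_apply]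
  simp only [h1]
  rw [pow_succ' σ (p + 1), Perm.mul_apply, hx]
  simp only [pow_zero, Perm.one_apply, zero_add, pow_one]
  rfl

theorem re_cycleProd_eq_of_sameCycle (A : Matrix ι ι ℍ[ℝ]) {σ : Perm ι} {x y : ι}
    (h : σ.SameCycle x y) : (cycleProd A σ y).re = (cycleProd A σ x).re := by
  obtain ⟨t, rfl⟩ := h.exists_nat_pow_eq
  induction t with
  | zero => rfl
  | succ t ih =>
    rw [pow_succ', Perm.mul_apply, re_cycleProd_apply]
    exact ih ((sameCycle_pow_right).2 (SameCycle.refl _ _))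

theorem cycleProd_eq_apply_of_fixed (A : Matrix ι ι ℍ[ℝ]) {σ : Perm ι} {x : ι} (h : σ x = x) :
    cycleProd A σ x = A x x := by
  have : Function.minimalPeriod σ x = 1 := Function.minimalPeriod_eq_one_iff_isFixedPt.2 h
  simp [cycleProd, this, h]

/-- The part of `cycleProd A σ x` that follows its first factor. -/
noncomputable def cycleTail (A : Matrix ι ι ℍ[ℝ]) (σ : Perm ι) (x : ι) : ℍ[ℝ] :=
  ((List.range (Function.minimalPeriod σ x - 1)).map
    fun t => A ((σ ^ (t + 1)) x) ((σ ^ (t + 2)) x)).prod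

/-- The path leaves `x` only once, so row `x` enters only through the leftmost factor. This makes
row determinants left-linear in the replaced row. -/
theorem cycleProd_updateRow (A : Matrix ι ι ℍ[ℝ]) (σ : Perm ι) (x : ι) (b : ι → ℍ[ℝ]) :
    cycleProd (A.updateRow x b) σ x = b (σ x) * cycleTail A σ x := by
  obtain ⟨p, hp⟩ := Nat.exists_eq_succ_of_ne_zero (minimalPeriod_pos σ x).ne'
  unfold cycleProd cycleTail
  rw [hp, Nat.succ_sub_one, List.range_succ_eq_map]
  simp only [List.map_cons, List.prod_cons, List.map_map, pow_zero, Perm.one_apply, zero_add,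
    pow_one, Matrix.updateRow_self]
  congr 2
  refine List.map_congr_left fun t ht => ?_
  have ht' : t < p := List.mem_range.1 ht
  have : (σ ^ (t + 1)) x ≠ x := pow_apply_ne_of_lt_minimalPeriod (by omega) (by omega)
  simp only [Function.comp, Nat.succ_eq_add_one]
  rw [Matrix.updateRow_ne this]

/-! ### Joining two cycles -/

section Join

variable {τ : Perm ι} {i j : ι}

theorem mul_swap_apply_of_not_sameCycle (z : ι) (hi : ¬ τ.SameCycle i z)
    (hj : ¬ τ.SameCycle j z) : (τ * swap j i) z = τ z := by
  rw [Perm.mul_apply, swap_apply_of_ne_of_ne]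
  · rintro rfl; exact hj (SameCycle.refl _ _)
  · rintro rfl; exact hi (SameCycle.refl _ _)

/-- The joined cycle runs `j → τ i → ⋯ → i → τ j → ⋯ → j`: first around the old cycle of `i`, then
around that of `j`. -/
theorem mul_swap_pow_apply_left (h : ¬ τ.SameCycle j i) {t : ℕ} (h0 : 0 < t)
    (ht : t ≤ Function.minimalPeriod τ i) : ((τ * swap j i) ^ t) j = (τ ^ t) i := by
  induction t with
  | zero => omega
  | succ t ih =>
    rw [pow_succ', pow_succ', Perm.mul_apply, Perm.mul_apply τ]
    rcases Nat.eq_zero_or_pos t with rfl | htp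
    · simp
    · rw [ih htp (by omega), Perm.mul_apply, swap_apply_of_ne_of_ne]
      · intro hc
        exact h (hc ▸ (sameCycle_pow_left).2 (SameCycle.refl _ _))
      · exact pow_apply_ne_of_lt_minimalPeriod htp (by omega)

theorem mul_swap_pow_apply_right (h : ¬ τ.SameCycle j i) {t : ℕ} (h0 : 0 < t)
    (ht : t ≤ Function.minimalPeriod τ j) :
    ((τ * swap j i) ^ (Function.minimalPeriod τ i + t)) j = (τ ^ t) j := by
  induction t with
  | zero => omega
  | succ t ih =>
    rw [← add_assoc, pow_succ', pow_succ', Perm.mul_apply, Perm.mul_apply τ]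
    rcases Nat.eq_zero_or_pos t with rfl | htp
    · rw [add_zero, mul_swap_pow_apply_left h (minimalPeriod_pos τ i) le_rfl,
        pow_minimalPeriod_apply]
      simp
    · rw [ih htp (by omega), Perm.mul_apply, swap_apply_of_ne_of_ne]
      · exact pow_apply_ne_of_lt_minimalPeriod htp (by omega)
      · intro hc
        exact h (hc ▸ (sameCycle_pow_right).2 (SameCycle.refl _ _))

theorem minimalPeriod_mul_swap (h : ¬ τ.SameCycle j i) :
    Function.minimalPeriod (τ * swap j i : Perm ι) j =
      Function.minimalPeriod τ i + Function.minimalPeriod τ j := by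
  have h1 := minimalPeriod_pos τ i
  have h2 := minimalPeriod_pos τ j
  refine minimalPeriod_eq_of_first_return (by omega) ?_ ?_
  · rw [mul_swap_pow_apply_right h h2 le_rfl, pow_minimalPeriod_apply]
  · intro t h0 ht
    rcases le_or_gt t (Function.minimalPeriod τ i) with hle | hgt
    · rw [mul_swap_pow_apply_left h h0 hle]
      intro hc
      exact h (hc ▸ (sameCycle_pow_left).2 (SameCycle.refl _ _))
    · obtain ⟨s, rfl⟩ := Nat.exists_eq_add_of_lt hgt
      rw [add_assoc, mul_swap_pow_apply_right h (by omega) (by omega)]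
      exact pow_apply_ne_of_lt_minimalPeriod (by omega) (by omega)

theorem sameCycle_mul_swap (h : ¬ τ.SameCycle j i) (z : ι) :
    (τ * swap j i).SameCycle j z ↔ τ.SameCycle j z ∨ τ.SameCycle i z := by
  have h1 := minimalPeriod_pos τ i
  have h2 := minimalPeriod_pos τ j
  -- Exponents are reduced to `1, …, period` instead of `0, …, period - 1`, since the formulas for
  -- powers of `τ * swap j i` need a positive exponent.
  have hred : ∀ (ρ : Perm ι) (x : ι) (t : ℕ), ∃ s, 0 < s ∧ s ≤ Function.minimalPeriod ρ x ∧
      (ρ ^ t) x = (ρ ^ s) x := by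
    intro ρ x t
    have hmod : (ρ ^ t) x = (ρ ^ (t % Function.minimalPeriod ρ x)) x := by
      rw [Perm.coe_pow, Perm.coe_pow]
      exact Function.iterate_mod_minimalPeriod_eq.symm
    have hpos := minimalPeriod_pos ρ x
    rcases Nat.eq_zero_or_pos (t % Function.minimalPeriod ρ x) with h0 | h0
    · exact ⟨_, hpos, le_rfl, by rw [hmod, h0, pow_minimalPeriod_apply]; rfl⟩
    · exact ⟨_, h0, (Nat.mod_lt _ hpos).le, hmod⟩
  constructor
  · intro hz
    obtain ⟨t, rfl⟩ := hz.exists_nat_pow_eq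
    obtain ⟨s, hs0, hs, hts⟩ := hred (τ * swap j i) j t
    rw [hts]
    rw [minimalPeriod_mul_swap h] at hs
    rcases le_or_gt s (Function.minimalPeriod τ i) with hle | hgt
    · right
      rw [mul_swap_pow_apply_left h hs0 hle]
      exact (sameCycle_pow_right).2 (SameCycle.refl _ _)
    · left
      obtain ⟨u, rfl⟩ := Nat.exists_eq_add_of_lt hgt
      rw [add_assoc, mul_swap_pow_apply_right h (by omega) (by omega)]
      exact (sameCycle_pow_right).2 (SameCycle.refl _ _)
  · rintro (hz | hz)
    · obtain ⟨t, rfl⟩ := hz.exists_nat_pow_eq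
      obtain ⟨s, hs0, hs, hts⟩ := hred τ j t
      rw [hts, ← mul_swap_pow_apply_right h hs0 hs]
      exact (sameCycle_pow_right).2 (SameCycle.refl _ _)
    · obtain ⟨t, rfl⟩ := hz.exists_nat_pow_eq
      obtain ⟨s, hs0, hs, hts⟩ := hred τ i t
      rw [hts, ← mul_swap_pow_apply_left h hs0 hs]
      exact (sameCycle_pow_right).2 (SameCycle.refl _ _)

/-- The step out of `j` now lands on `τ i` and carries an entry of `b`; the step out of `i` lands on
`τ j` and carries an entry of row `i`. Hence the two replaced rows on the right. -/
theorem cycleProd_mul_swap (h : ¬ τ.SameCycle j i) (A : Matrix ι ι ℍ[ℝ]) (b : ι → ℍ[ℝ]) :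
    cycleProd (A.updateRow j b) (τ * swap j i) j =
      cycleProd (A.updateRow i b) τ i * cycleProd (A.updateRow j (A i)) τ j := by
  have hij : i ≠ j := by rintro rfl; exact h (SameCycle.refl _ _)
  unfold cycleProd
  rw [minimalPeriod_mul_swap h, List.range_add, List.map_append, List.prod_append, List.map_map]
  congr 2
  · refine List.map_congr_left fun t ht => ?_
    have ht' := List.mem_range.1 ht
    rw [mul_swap_pow_apply_left h (Nat.succ_pos t) ht']
    rcases Nat.eq_zero_or_pos t with rfl | h0
    · simp
    · rw [mul_swap_pow_apply_left h h0 ht'.le, Matrix.updateRow_ne, Matrix.updateRow_ne]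
      · exact pow_apply_ne_of_lt_minimalPeriod h0 ht'
      · intro hc
        exact h (hc ▸ (sameCycle_pow_left).2 (SameCycle.refl _ _))
  · refine List.map_congr_left fun t ht => ?_
    have ht' := List.mem_range.1 ht
    simp only [Function.comp]
    rw [add_assoc, mul_swap_pow_apply_right h (Nat.succ_pos t) ht']
    rcases Nat.eq_zero_or_pos t with rfl | h0
    · rw [add_zero, mul_swap_pow_apply_left h (minimalPeriod_pos τ i) le_rfl,
        pow_minimalPeriod_apply, Matrix.updateRow_ne hij]
      simp
    · have hne : (τ ^ t) j ≠ j := pow_apply_ne_of_lt_minimalPeriod h0 ht'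
      rw [mul_swap_pow_apply_right h h0 ht'.le, Matrix.updateRow_ne hne, Matrix.updateRow_ne hne]

theorem not_sameCycle_mul_swap (hij : i ≠ j) (h : τ.SameCycle j i) :
    ¬ (τ * swap j i).SameCycle j i := by
  obtain ⟨t, ht⟩ := h.exists_nat_pow_eq
  classical
  have hex : ∃ t, (τ ^ t) j = i := ⟨t, ht⟩
  -- `q` is the first time at which the `τ`-path from `j` reaches `i`. After the swap, the path from
  -- `i` is `i → τ j → ⋯ → (τ ^ q) j = i`, which closes without meeting `j`.
  set q := Nat.find hex with hq
  have hqi : (τ ^ q) j = i := Nat.find_spec hex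
  have hmin : ∀ s < q, (τ ^ s) j ≠ i := fun s hs => Nat.find_min hex hs
  have hq0 : 0 < q := by
    rcases Nat.eq_zero_or_pos q with h0 | h0
    · rw [h0] at hqi; exact absurd hqi.symm hij
    · exact h0
  have hnej : ∀ s, 0 < s → s ≤ q → (τ ^ s) j ≠ j := by
    intro s hs0 hsq hc
    refine hmin (q - s) (by omega) ?_
    have : (τ ^ (q - s + s)) j = i := by rw [Nat.sub_add_cancel hsq]; exact hqi
    rwa [pow_add, Perm.mul_apply, hc] at this
  have hpow : ∀ s, 0 < s → s ≤ q → ((τ * swap j i) ^ s) i = (τ ^ s) j := by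
    intro s
    induction s with
    | zero => intro h; omega
    | succ s ih =>
      intro _ hs
      rw [pow_succ', pow_succ', Perm.mul_apply, Perm.mul_apply τ]
      rcases Nat.eq_zero_or_pos s with rfl | hs0
      · simp
      · rw [ih hs0 (by omega), Perm.mul_apply, swap_apply_of_ne_of_ne]
        · exact hnej s hs0 (by omega)
        · exact hmin s (by omega)
  intro hc
  obtain ⟨u, hu⟩ := hc.symm.exists_nat_pow_eq
  have hper : Function.IsPeriodicPt (τ * swap j i : Perm ι) q i := by
    rw [Function.IsPeriodicPt, Function.IsFixedPt, ← Perm.coe_pow, hpow q hq0 le_rfl, hqi]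
  have hmod : ((τ * swap j i) ^ (u % q)) i = j := by
    rw [Perm.coe_pow, Function.IsPeriodicPt.iterate_mod_apply hper, ← Perm.coe_pow, hu]
  rcases Nat.eq_zero_or_pos (u % q) with h0 | h0
  · rw [h0] at hmod; exact hij hmod
  · have hlt := Nat.mod_lt u hq0
    rw [hpow _ h0 hlt.le] at hmod
    exact hnej _ h0 hlt.le hmod

end Join

/-! ### Reversing one cycle -/

/-- The permutation obtained from `σ` by reversing its cycle through `x`. -/
noncomputable def reverseCycle (σ : Perm ι) (x : ι) : Perm ι :=
  σ * (σ.cycleOf x)⁻¹ * (σ.cycleOf x)⁻¹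

theorem reverseCycle_apply_of_not_sameCycle {σ : Perm ι} {x y : ι} (h : ¬ σ.SameCycle x y) :
    reverseCycle σ x y = σ y := by
  have : (σ.cycleOf x)⁻¹ y = y := by
    rw [Perm.inv_eq_iff_eq, cycleOf_apply_of_not_sameCycle h]
  rw [reverseCycle, Perm.mul_apply, Perm.mul_apply, this, this]

theorem reverseCycle_apply_of_sameCycle {σ : Perm ι} {x y : ι} (h : σ.SameCycle x y) :
    reverseCycle σ x y = σ⁻¹ y := by
  have key : ∀ y, σ.SameCycle x y → (σ.cycleOf x)⁻¹ y = σ⁻¹ y := by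
    intro y hy
    rw [cycleOf_inv, cycleOf_apply, if_pos (sameCycle_inv.2 hy)]
  have h2 : σ.SameCycle x (σ⁻¹ y) := by
    have : σ.SameCycle x (σ (σ⁻¹ y)) := by simpa using h
    exact sameCycle_apply_right.1 this
  rw [reverseCycle, Perm.mul_apply, Perm.mul_apply, key y h, key _ h2]
  simp

/-- The inverse cycle is multiplied in twice, so its sign cancels. -/
theorem sign_reverseCycle (σ : Perm ι) (x : ι) : sign (reverseCycle σ x) = sign σ := by
  simp [reverseCycle, mul_assoc]

theorem sameCycle_reverseCycle (σ : Perm ι) (x y z : ι) :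
    (reverseCycle σ x).SameCycle y z ↔ σ.SameCycle y z := by
  by_cases h : σ.SameCycle x y
  · rw [sameCycle_iff_of_agree (σ := σ⁻¹), sameCycle_inv]
    intro w hw
    exact reverseCycle_apply_of_sameCycle (h.trans (sameCycle_inv.1 hw))
  · refine sameCycle_iff_of_agree (fun w hw => reverseCycle_apply_of_not_sameCycle ?_) _
    exact fun hc => h (hc.trans hw.symm)

theorem reverseCycle_reverseCycle (σ : Perm ι) (x : ι) :
    reverseCycle (reverseCycle σ x) x = σ := by
  ext y
  by_cases h : σ.SameCycle x y
  · rw [reverseCycle_apply_of_sameCycle ((sameCycle_reverseCycle _ _ _ _).2 h),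
      Perm.inv_eq_iff_eq, reverseCycle_apply_of_sameCycle (sameCycle_apply_right.2 h)]
    simp
  · rw [reverseCycle_apply_of_not_sameCycle fun hc => h ((sameCycle_reverseCycle _ _ _ _).1 hc),
      reverseCycle_apply_of_not_sameCycle h]

theorem cycleProd_reverseCycle_of_not_sameCycle (A : Matrix ι ι ℍ[ℝ]) {σ : Perm ι} {x y : ι}
    (h : ¬ σ.SameCycle x y) : cycleProd A (reverseCycle σ x) y = cycleProd A σ y :=
  cycleProd_congr
    (fun _ hw => reverseCycle_apply_of_not_sameCycle fun hc => h (hc.trans hw.symm))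
    fun _ _ _ _ => rfl

theorem cycleProd_reverseCycle_self {A : Matrix ι ι ℍ[ℝ]} {σ : Perm ι} {x : ι}
    (hA : ∀ z w, σ.SameCycle x z → σ.SameCycle x w → star (A z w) = A w z) :
    cycleProd A (reverseCycle σ x) x = star (cycleProd A σ x) := by
  rw [← cycleProd_inv hA]
  exact cycleProd_congr
    (fun _ hw => reverseCycle_apply_of_sameCycle (sameCycle_inv.1 hw)) fun _ _ _ _ => rfl

end Cycles

/-! ### Row determinants in terms of real parts of cycle products -/

section RealParts

set_option linter.unusedSectionVars false

variable {ι : Type*} [Fintype ι] [LinearOrder ι]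

open Equiv Equiv.Perm

/-- The permutations that fix every point outside `α`. -/
def permsOn (α : Finset ι) : Finset (Perm ι) :=
  Finset.univ.filter fun σ => ∀ x, x ∉ α → σ x = x

theorem mem_permsOn {α : Finset ι} {σ : Perm ι} : σ ∈ permsOn α ↔ ∀ x, x ∉ α → σ x = x := by
  simp [permsOn]

/-- The least elements of the cycles of `σ` that lie in `α`. -/
def leaders (α : Finset ι) (σ : Perm ι) : Finset ι :=
  α.filter fun x => ∀ y, σ.SameCycle x y → x ≤ y

theorem mem_leaders {α : Finset ι} {σ : Perm ι} {x : ι} :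
    x ∈ leaders α σ ↔ x ∈ α ∧ ∀ y, σ.SameCycle x y → x ≤ y := by
  simp [leaders]

/-- The least elements of the cycles of `σ` that lie in `α` but not on the cycle of `j`. -/
def offLeaders (α : Finset ι) (σ : Perm ι) (j : ι) : Finset ι :=
  (leaders α σ).filter fun x => ¬ σ.SameCycle j x

theorem mem_offLeaders {α : Finset ι} {σ : Perm ι} {j x : ι} :
    x ∈ offLeaders α σ j ↔ x ∈ leaders α σ ∧ ¬ σ.SameCycle j x := by
  simp [offLeaders]

theorem mem_cycleLeaders {σ : Perm ι} {j x : ι} :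
    x ∈ cycleLeaders σ j ↔ x ∈ offLeaders Finset.univ σ j := by
  simp [cycleLeaders, mem_offLeaders, mem_leaders, and_comm]

theorem cycleLeaders_reverseCycle (σ : Perm ι) (x j : ι) :
    cycleLeaders (reverseCycle σ x) j = cycleLeaders σ j := by
  unfold cycleLeaders
  congr 1
  ext y
  simp [sameCycle_reverseCycle]

/-- An ordered product is additive in a single slot, and the scalar 2 is central, so it can be
pulled out of that slot. -/
theorem prod_map_add_prod_map {L : List ι} (hL : L.Nodup) {x : ι} (hx : x ∈ L)
    {f f' g : ι → ℍ[ℝ]} (hf : ∀ y ∈ L, y ≠ x → f y = g y) (hf' : ∀ y ∈ L, y ≠ x → f' y = g y)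
    (hfx : f x + f' x = 2 * g x) :
    (L.map f).prod + (L.map f').prod = 2 * (L.map g).prod := by
  obtain ⟨L₁, L₂, rfl⟩ := List.append_of_mem hx
  have hne₁ : ∀ y ∈ L₁, y ≠ x := by
    rintro y hy rfl
    exact (List.nodup_append.1 hL).2.2 y hy y (by simp) rfl
  have hne₂ : ∀ y ∈ L₂, y ≠ x := by
    rintro y hy rfl
    exact (List.nodup_cons.1 (List.nodup_append.1 hL).2.1).1 hy
  have e₁ : ∀ h : ι → ℍ[ℝ], (∀ y ∈ L₁ ++ x :: L₂, y ≠ x → h y = g y) →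
      L₁.map h = L₁.map g ∧ L₂.map h = L₂.map g := fun h hh =>
    ⟨List.map_congr_left fun y hy => hh y (by simp [hy]) (hne₁ y hy),
      List.map_congr_left fun y hy => hh y (by simp [hy]) (hne₂ y hy)⟩
  simp only [List.map_append, List.map_cons, List.prod_append, List.prod_cons]
  rw [(e₁ f hf).1, (e₁ f hf).2, (e₁ f' hf').1, (e₁ f' hf').2, ← mul_add, ← add_mul, hfx]
  have hc : ∀ a : ℍ[ℝ], a * 2 = 2 * a := fun a => (Commute.ofNat_right a 2).eq
  rw [mul_assoc, ← mul_assoc _ 2, hc, mul_assoc]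

theorem quaternion_two_ne_zero : (2 : ℍ[ℝ]) ≠ 0 := by
  intro h
  have h1 : (1 + 1 : ℍ[ℝ]).re = 0 := by rw [one_add_one_eq_two, h, Quaternion.re_zero]
  simp at h1

/-- `S` collects the leaders whose products have already been made real; the induction treats one
leader at a time, leaving the order of the factors intact. -/
theorem sum_cycleLeaders_real {A : Matrix ι ι ℍ[ℝ]} {j : ι}
    (hA : ∀ p q, p ≠ j → q ≠ j → star (A p q) = A q p) (S : Finset ι) :
    rdet j A = ∑ σ : Perm ι, (((sign σ : ℤˣ) : ℤ) : ℍ[ℝ]) *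
      (cycleProd A σ j * ((cycleLeaders σ j).map fun x =>
        if x ∈ S then (((cycleProd A σ x).re : ℝ) : ℍ[ℝ]) else cycleProd A σ x).prod) := by
  induction S using Finset.induction_on with
  | empty => simp [rdet]
  | insert x S hxS ih =>
    rw [ih]
    set T : Finset ι → Perm ι → ℍ[ℝ] := fun S σ => (((sign σ : ℤˣ) : ℤ) : ℍ[ℝ]) *
      (cycleProd A σ j * ((cycleLeaders σ j).map fun x =>
        if x ∈ S then (((cycleProd A σ x).re : ℝ) : ℍ[ℝ]) else cycleProd A σ x).prod) with hT
    change ∑ σ, T S σ = ∑ σ, T (insert x S) σ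
    -- Pairing `σ` with `φ σ` averages a cycle product with its conjugate. The reversed cycle avoids
    -- `j`, so symmetry off row and column `j` suffices.
    let φ : Perm ι → Perm ι := fun σ => if x ∈ cycleLeaders σ j then reverseCycle σ x else σ
    have hφ : Function.Involutive φ := by
      intro σ
      by_cases hx : x ∈ cycleLeaders σ j
      · simp [φ, hx, cycleLeaders_reverseCycle, reverseCycle_reverseCycle]
      · simp [φ, hx]
    have hsum : ∑ σ, T S (φ σ) = ∑ σ, T S σ := Equiv.sum_comp (hφ.toPerm φ) (T S)
    have key : ∀ σ, T S σ + T S (φ σ) = 2 * T (insert x S) σ := by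
      intro σ
      by_cases hx : x ∈ cycleLeaders σ j
      · have hxj : ¬ σ.SameCycle j x := (mem_offLeaders.1 (mem_cycleLeaders.1 hx)).2
        have hlead := (mem_leaders.1 (mem_offLeaders.1 (mem_cycleLeaders.1 hx)).1).2
        have hnd : (cycleLeaders σ j).Nodup := Finset.sort_nodup _ _
        simp only [hT, φ, hx, if_true]
        rw [sign_reverseCycle, cycleLeaders_reverseCycle,
          cycleProd_reverseCycle_of_not_sameCycle A fun h => hxj h.symm, ← mul_add, ← mul_add,
          prod_map_add_prod_map hnd hx
            (g := fun y => if y ∈ insert x S then (((cycleProd A σ y).re : ℝ) : ℍ[ℝ])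
              else cycleProd A σ y)]
        · have hc : ∀ a : ℍ[ℝ], a * 2 = 2 * a := fun a => (Commute.ofNat_right a 2).eq
          rw [← mul_assoc _ 2, hc, mul_assoc, ← mul_assoc _ 2, hc, mul_assoc]
        · intro y _ hyx
          simp [hyx]
        · intro y hy hyx
          have hxy : ¬ σ.SameCycle x y := by
            intro h
            have h1 := hlead y h
            have h2 := (mem_leaders.1 (mem_offLeaders.1 (mem_cycleLeaders.1 hy)).1).2 x h.symm
            exact hyx (le_antisymm h2 h1)
          simp [hyx, cycleProd_reverseCycle_of_not_sameCycle A hxy]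
        · have hstar : cycleProd A (reverseCycle σ x) x = star (cycleProd A σ x) := by
            refine cycleProd_reverseCycle_self fun z w hz hw => hA _ _ ?_ ?_
            · rintro rfl; exact hxj hz.symm
            · rintro rfl; exact hxj hw.symm
          simp only [hxS, if_false, Finset.mem_insert_self, if_true, hstar]
          rw [Quaternion.self_add_star]
      · have : T (insert x S) σ = T S σ := by
          simp only [hT]
          congr 3
          refine List.map_congr_left fun y hy => ?_
          have : y ≠ x := by rintro rfl; exact hx hy
          simp [this]
        simp only [φ, hx, if_false, this, two_mul]
    have h2 : (2 : ℍ[ℝ]) * ∑ σ, T S σ = 2 * ∑ σ, T (insert x S) σ := by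
      rw [Finset.mul_sum _ _ (2 : ℍ[ℝ]), Finset.mul_sum _ _ (2 : ℍ[ℝ])]
      rw [← Finset.sum_congr rfl fun σ _ => key σ, Finset.sum_add_distrib, hsum,
        ← Finset.mul_sum, two_mul]
    exact mul_left_cancel₀ quaternion_two_ne_zero h2

/-- In a row determinant along `j` of a matrix that is Hermitian off the row and column of `j`,
the cycle products off the cycle of `j` may be replaced by their real parts. -/
theorem rdet_eq_sum_re {A : Matrix ι ι ℍ[ℝ]} {j : ι}
    (hA : ∀ p q, p ≠ j → q ≠ j → star (A p q) = A q p) :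
    rdet j A = ∑ σ : Perm ι, (((sign σ : ℤˣ) : ℤ) : ℍ[ℝ]) *
      (cycleProd A σ j *
        ((∏ x ∈ offLeaders Finset.univ σ j, (cycleProd A σ x).re : ℝ) : ℍ[ℝ])) := by
  rw [sum_cycleLeaders_real hA Finset.univ]
  refine Finset.sum_congr rfl fun σ _ => ?_
  congr 2
  simp only [Finset.mem_univ, if_true]
  have h1 : (cycleLeaders σ j).map (fun x => (((cycleProd A σ x).re : ℝ) : ℍ[ℝ])) =
      ((cycleLeaders σ j).map fun x => (cycleProd A σ x).re).map (algebraMap ℝ ℍ[ℝ]) := by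
    rw [List.map_map]; rfl
  rw [h1, ← map_list_prod]
  have hnd : (cycleLeaders σ j).Nodup := Finset.sort_nodup _ _
  rw [← List.prod_toFinset _ hnd]
  have : (cycleLeaders σ j).toFinset = offLeaders Finset.univ σ j := by
    ext x; rw [List.mem_toFinset, mem_cycleLeaders]
  rw [this]; rfl

/-! ### Principal minors and row-replaced minors on an index set -/

/-- The principal minor of `M` on `α`, as a real number. -/
noncomputable def minor (M : Matrix ι ι ℍ[ℝ]) (α : Finset ι) : ℝ :=
  ∑ σ ∈ permsOn α, ((sign σ : ℤˣ) : ℤ) * ∏ x ∈ leaders α σ, (cycleProd M σ x).re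

/-- The row determinant along `j` of the principal submatrix of `M` on `α`, the row of `j` being
replaced by `b`. -/
noncomputable def rowMinor (M : Matrix ι ι ℍ[ℝ]) (α : Finset ι) (j : ι) (b : ι → ℍ[ℝ]) : ℍ[ℝ] :=
  ∑ σ ∈ permsOn α, (((sign σ : ℤˣ) : ℤ) : ℍ[ℝ]) *
    (cycleProd (M.updateRow j b) σ j *
      ((∏ x ∈ offLeaders α σ j, (cycleProd M σ x).re : ℝ) : ℍ[ℝ]))

theorem apply_mem_of_mem_permsOn {α : Finset ι} {σ : Perm ι} (hσ : σ ∈ permsOn α) {x : ι} :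
    σ x ∈ α ↔ x ∈ α := by
  rw [mem_permsOn] at hσ
  constructor
  · intro h
    by_contra hx
    exact hx (hσ x hx ▸ h)
  · intro h
    by_contra hx
    have := σ.injective (hσ _ hx)
    rw [this] at hx
    exact hx h

theorem mem_of_sameCycle {α : Finset ι} {σ : Perm ι} (hσ : σ ∈ permsOn α) {x y : ι}
    (h : σ.SameCycle x y) (hx : x ∈ α) : y ∈ α := by
  obtain ⟨t, rfl⟩ := h.exists_nat_pow_eq
  clear h
  induction t with
  | zero => exact hx
  | succ t ih =>
    rw [pow_succ', Perm.mul_apply]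
    exact (apply_mem_of_mem_permsOn hσ).2 ih

/-- Exactly one leader lies on the cycle of `j`, and it may be traded for `j` because real parts are
constant along a cycle. The filter `P` lets a second cycle be set aside. -/
theorem prod_filter_leaders_eq {α : Finset ι} {σ : Perm ι} (hσ : σ ∈ permsOn α) {j : ι}
    (hj : j ∈ α) (M : Matrix ι ι ℍ[ℝ]) (P : ι → Prop) [DecidablePred P]
    (hP : ∀ y, σ.SameCycle j y → P y) :
    ∏ x ∈ (leaders α σ).filter P, (cycleProd M σ x).re =
      (cycleProd M σ j).re * ∏ x ∈ (offLeaders α σ j).filter P, (cycleProd M σ x).re := by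
  have hne : (Finset.univ.filter fun y => σ.SameCycle j y).Nonempty :=
    ⟨j, by simpa using SameCycle.refl σ j⟩
  set l := (Finset.univ.filter fun y => σ.SameCycle j y).min' hne with hl
  have hjl : σ.SameCycle j l := by
    have := Finset.min'_mem _ hne
    simpa using this
  have hmin : ∀ y, σ.SameCycle j y → l ≤ y := fun y hy => Finset.min'_le _ _ (by simpa using hy)
  have hset : (leaders α σ).filter P = insert l ((offLeaders α σ j).filter P) := by
    ext x
    rw [Finset.mem_insert, Finset.mem_filter, Finset.mem_filter, mem_offLeaders]
    constructor
    · rintro ⟨hx, hPx⟩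
      by_cases hjx : σ.SameCycle j x
      · left
        exact le_antisymm ((mem_leaders.1 hx).2 _ (hjx.symm.trans hjl)) (hmin x hjx)
      · exact Or.inr ⟨⟨hx, hjx⟩, hPx⟩
    · rintro (rfl | hx)
      · exact ⟨mem_leaders.2 ⟨mem_of_sameCycle hσ hjl hj, fun y hy => hmin y (hjl.trans hy)⟩,
          hP _ hjl⟩
      · exact ⟨hx.1.1, hx.2⟩
  rw [hset, Finset.prod_insert, re_cycleProd_eq_of_sameCycle M hjl]
  intro h
  exact (mem_offLeaders.1 (Finset.mem_filter.1 h).1).2 hjl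

theorem prod_leaders_eq {α : Finset ι} {σ : Perm ι} (hσ : σ ∈ permsOn α) {j : ι} (hj : j ∈ α)
    (M : Matrix ι ι ℍ[ℝ]) :
    ∏ x ∈ leaders α σ, (cycleProd M σ x).re =
      (cycleProd M σ j).re * ∏ x ∈ offLeaders α σ j, (cycleProd M σ x).re := by
  simpa using prod_filter_leaders_eq hσ hj M (fun _ => True) fun _ _ => trivial

end RealParts

/-! ### Principal submatrices: permutations of a subset versus permutations fixing its complement -/

section Transfer

variable {n : ℕ}

open Equiv Equiv.Perm

theorem ofSubtype_pow_apply {α : Finset (Fin n)} (σ : Perm {x // x ∈ α}) (x : {x // x ∈ α})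
    (t : ℕ) : (ofSubtype σ ^ t) (x : Fin n) = ((σ ^ t) x : {x // x ∈ α}) := by
  rw [← map_pow, ofSubtype_apply_coe]

theorem sameCycle_ofSubtype {α : Finset (Fin n)} {σ : Perm {x // x ∈ α}} {x y : {x // x ∈ α}} :
    (ofSubtype σ).SameCycle (x : Fin n) y ↔ σ.SameCycle x y := by
  constructor
  · intro h
    obtain ⟨t, ht⟩ := h.exists_nat_pow_eq
    rw [ofSubtype_pow_apply] at ht
    exact ⟨t, by simpa using Subtype.ext ht⟩
  · intro h
    obtain ⟨t, ht⟩ := h.exists_nat_pow_eq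
    exact ⟨t, by rw [zpow_natCast, ofSubtype_pow_apply, ht]⟩

theorem cycleProd_ofSubtype (A : Matrix (Fin n) (Fin n) ℍ[ℝ]) {α : Finset (Fin n)}
    (σ : Perm {x // x ∈ α}) (x : {x // x ∈ α}) :
    cycleProd A (ofSubtype σ) x = cycleProd (principal A α) σ x := by
  have hp : Function.minimalPeriod (ofSubtype σ : Perm (Fin n)) (x : Fin n) =
      Function.minimalPeriod σ x := by
    refine minimalPeriod_eq_of_first_return (minimalPeriod_pos σ x) ?_ ?_
    · rw [ofSubtype_pow_apply, pow_minimalPeriod_apply]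
    · intro t h0 ht
      rw [ofSubtype_pow_apply]
      exact fun hc => pow_apply_ne_of_lt_minimalPeriod h0 ht (Subtype.ext hc)
  unfold cycleProd principal
  rw [hp]
  simp only [ofSubtype_pow_apply, Matrix.submatrix_apply]

/-- Permutations of `α` are extended by the identity. Leaders correspond because the subtype has the
induced order, and cycles avoiding `j` do not see the replaced row. -/
theorem rdet_principal_updateRow {M : Matrix (Fin n) (Fin n) ℍ[ℝ]} (hM : M.IsHermitian)
    {α : Finset (Fin n)} {j : Fin n} (hj : j ∈ α) (b : Fin n → ℍ[ℝ]) :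
    rdet ⟨j, hj⟩ (principal (M.updateRow j b) α) = rowMinor M α j b := by
  rw [rdet_eq_sum_re, rowMinor]
  · refine Finset.sum_bij (fun σ _ => ofSubtype σ) ?_ ?_ ?_ ?_
    · intro σ _
      exact mem_permsOn.2 fun x hx => ofSubtype_apply_of_not_mem σ hx
    · intro σ _ τ _ h
      exact ofSubtype_injective h
    · intro τ hτ
      refine ⟨τ.subtypePerm fun x => apply_mem_of_mem_permsOn hτ, Finset.mem_univ _, ?_⟩
      refine ofSubtype_subtypePerm _ fun x hx => ?_
      by_contra hxα
      exact hx (mem_permsOn.1 hτ x hxα)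
    · intro σ _
      rw [sign_ofSubtype, ← cycleProd_ofSubtype]
      congr 3
      refine Finset.prod_bij (fun x _ => (x : Fin n)) ?_ ?_ ?_ ?_
      · intro x hx
        rw [mem_offLeaders, mem_leaders] at hx ⊢
        refine ⟨⟨x.2, fun y hy => ?_⟩, fun h => hx.2 (sameCycle_ofSubtype.1 h)⟩
        have hyα : y ∈ α := mem_of_sameCycle
          (mem_permsOn.2 fun x hx => ofSubtype_apply_of_not_mem σ hx) hy x.2
        exact hx.1.2 ⟨y, hyα⟩ (sameCycle_ofSubtype.1 hy)
      · intro x _ y _ h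
        exact Subtype.ext h
      · intro y hy
        rw [mem_offLeaders, mem_leaders] at hy
        refine ⟨⟨y, hy.1.1⟩, ?_, rfl⟩
        rw [mem_offLeaders, mem_leaders]
        exact ⟨⟨Finset.mem_univ _, fun z hz => hy.1.2 z (sameCycle_ofSubtype.2 hz)⟩,
          fun h => hy.2 (sameCycle_ofSubtype.2 h)⟩
      · intro x hx
        rw [← cycleProd_ofSubtype]
        congr 1
        refine cycleProd_congr (fun _ _ => rfl) fun z w hz _ => ?_
        rw [Matrix.updateRow_ne]
        rintro rfl
        exact (mem_offLeaders.1 hx).2 (sameCycle_ofSubtype.1 hz.symm)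
  · intro p q hp hq
    have hp' : (p : Fin n) ≠ j := fun h => hp (Subtype.ext h)
    have hq' : (q : Fin n) ≠ j := fun h => hq (Subtype.ext h)
    simp only [principal, Matrix.submatrix_apply, Matrix.updateRow_ne hp', Matrix.updateRow_ne hq']
    exact hM.apply _ _

end Transfer

/-! ### Laplace-type identities for Hermitian matrices -/

section Laplace

set_option linter.unusedSectionVars false

variable {ι : Type*} [Fintype ι] [LinearOrder ι]

open Equiv Equiv.Perm

theorem re_cycleProd_reverseCycle {M : Matrix ι ι ℍ[ℝ]} (hM : M.IsHermitian) (σ : Perm ι)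
    (x y : ι) : (cycleProd M (reverseCycle σ x) y).re = (cycleProd M σ y).re := by
  by_cases h : σ.SameCycle x y
  · rw [re_cycleProd_eq_of_sameCycle M ((sameCycle_reverseCycle σ x x y).2 h),
      re_cycleProd_eq_of_sameCycle M h, cycleProd_reverseCycle_self fun z w _ _ => hM.apply _ _,
      Quaternion.re_star]
  · rw [cycleProd_reverseCycle_of_not_sameCycle M h]

theorem leaders_reverseCycle (α : Finset ι) (σ : Perm ι) (x : ι) :
    leaders α (reverseCycle σ x) = leaders α σ := by
  ext y
  simp [mem_leaders, sameCycle_reverseCycle]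

theorem offLeaders_reverseCycle (α : Finset ι) (σ : Perm ι) (x j : ι) :
    offLeaders α (reverseCycle σ x) j = offLeaders α σ j := by
  ext y
  simp [mem_offLeaders, leaders_reverseCycle, sameCycle_reverseCycle]

theorem reverseCycle_mem_permsOn {α : Finset ι} {σ : Perm ι} (hσ : σ ∈ permsOn α) (x : ι) :
    reverseCycle σ x ∈ permsOn α := by
  rw [mem_permsOn] at hσ ⊢
  intro y hy
  by_cases h : σ.SameCycle x y
  · rw [reverseCycle_apply_of_sameCycle h, Perm.inv_eq_iff_eq, hσ y hy]
  · rw [reverseCycle_apply_of_not_sameCycle h, hσ y hy]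

theorem sum_reverseCycle (s : Finset (Perm ι)) (x : ι) (hs : ∀ σ ∈ s, reverseCycle σ x ∈ s)
    (F : Perm ι → ℍ[ℝ]) : ∑ σ ∈ s, F (reverseCycle σ x) = ∑ σ ∈ s, F σ :=
  Finset.sum_nbij' (fun σ => reverseCycle σ x) (fun σ => reverseCycle σ x) hs hs
    (fun σ _ => reverseCycle_reverseCycle σ x) (fun σ _ => reverseCycle_reverseCycle σ x)
    fun _ _ => rfl

/-- A sum over permutations whose terms contain the cycle product through `x` as a factor may be
taken with its real part instead. -/
theorem sum_cycleProd_eq_sum_re {M : Matrix ι ι ℍ[ℝ]} (hM : M.IsHermitian) (s : Finset (Perm ι))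
    (x : ι) (hs : ∀ σ ∈ s, reverseCycle σ x ∈ s) (F : Perm ι → ℍ[ℝ])
    (hF : ∀ σ ∈ s, F (reverseCycle σ x) = F σ) :
    ∑ σ ∈ s, cycleProd M σ x * F σ =
      ∑ σ ∈ s, (((cycleProd M σ x).re : ℝ) : ℍ[ℝ]) * F σ := by
  have h1 := sum_reverseCycle s x hs fun σ => cycleProd M σ x * F σ
  have h2 : ∑ σ ∈ s, cycleProd M (reverseCycle σ x) x * F (reverseCycle σ x) =
      ∑ σ ∈ s, star (cycleProd M σ x) * F σ :=
    Finset.sum_congr rfl fun σ hσ => by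
      rw [hF σ hσ, cycleProd_reverseCycle_self fun z w _ _ => hM.apply _ _]
  refine mul_left_cancel₀ quaternion_two_ne_zero ?_
  rw [two_mul]
  nth_rewrite 2 [← h1]
  rw [h2, ← Finset.sum_add_distrib, Finset.mul_sum]
  refine Finset.sum_congr rfl fun σ _ => ?_
  rw [← add_mul, Quaternion.self_add_star, mul_assoc]

theorem intCast_mul_left_comm (a : ℤ) (x y : ℍ[ℝ]) : (a : ℍ[ℝ]) * (x * y) = x * (a * y) := by
  rw [← mul_assoc, (Int.cast_commute a x).eq, mul_assoc]

/-- With nothing replaced, the cycle through `j` can be averaged too. The result is real and does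
not depend on `j`, so all row determinants agree. -/
theorem rowMinor_self {M : Matrix ι ι ℍ[ℝ]} (hM : M.IsHermitian) {α : Finset ι} {j : ι}
    (hj : j ∈ α) : rowMinor M α j (M j) = ((minor M α : ℝ) : ℍ[ℝ]) := by
  rw [rowMinor, Matrix.updateRow_eq_self]
  simp only [intCast_mul_left_comm]
  rw [sum_cycleProd_eq_sum_re hM _ j fun σ hσ => reverseCycle_mem_permsOn hσ j]
  · rw [minor, ← Quaternion.algebraMap_def, map_sum]
    refine Finset.sum_congr rfl fun σ hσ => ?_
    rw [prod_leaders_eq hσ hj, ← intCast_mul_left_comm]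
    simpa [Quaternion.algebraMap_def] using Or.inl (Quaternion.coe_intCast _).symm
  · intro σ _
    rw [sign_reverseCycle, offLeaders_reverseCycle]
    simp only [re_cycleProd_reverseCycle hM]

theorem offLeaders_mul_swap (α : Finset ι) {τ : Perm ι} {i j : ι} (h : ¬ τ.SameCycle j i) :
    offLeaders α (τ * swap j i) j = (offLeaders α τ j).filter fun x => ¬ τ.SameCycle i x := by
  ext x
  rw [Finset.mem_filter, mem_offLeaders, mem_offLeaders, sameCycle_mul_swap h, not_or, and_assoc]
  refine and_congr_left fun hx => ?_
  rw [mem_leaders, mem_leaders]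
  refine and_congr_right fun _ => forall_congr' fun y => ?_
  rw [sameCycle_iff_of_agree]
  intro z hz
  exact mul_swap_apply_of_not_sameCycle z (fun hc => hx.2 (hc.trans hz.symm))
    fun hc => hx.1 (hc.trans hz.symm)

theorem prod_offLeaders_mul_swap (M : Matrix ι ι ℍ[ℝ]) (α : Finset ι) {τ : Perm ι} {i j : ι}
    (h : ¬ τ.SameCycle j i) :
    ∏ x ∈ offLeaders α (τ * swap j i) j, (cycleProd M (τ * swap j i) x).re =
      ∏ x ∈ (offLeaders α τ j).filter (fun x => ¬ τ.SameCycle i x), (cycleProd M τ x).re := by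
  rw [offLeaders_mul_swap α h]
  refine Finset.prod_congr rfl fun x hx => ?_
  rw [Finset.mem_filter, mem_offLeaders] at hx
  congr 1
  refine cycleProd_congr (fun z hz => ?_) fun _ _ _ _ => rfl
  exact mul_swap_apply_of_not_sameCycle z (fun hc => hx.2 (hc.trans hz.symm))
    fun hc => hx.1.2 (hc.trans hz.symm)

theorem mul_swap_mem_permsOn {α : Finset ι} {τ : Perm ι} (hτ : τ ∈ permsOn α) {i j : ι}
    (hi : i ∈ α) (hj : j ∈ α) : τ * swap j i ∈ permsOn α := by
  rw [mem_permsOn] at hτ ⊢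
  intro x hx
  rw [Perm.mul_apply, swap_apply_of_ne_of_ne, hτ x hx]
  · rintro rfl; exact hx hj
  · rintro rfl; exact hx hi

/-- Replacing a row of a Hermitian matrix by another of its rows makes the row determinant vanish. -/
theorem rowMinor_row_of_ne {M : Matrix ι ι ℍ[ℝ]} (hM : M.IsHermitian) {α : Finset ι} {i j : ι}
    (hi : i ∈ α) (hj : j ∈ α) (hij : i ≠ j) : rowMinor M α j (M i) = 0 := by
  set s := (permsOn α).filter fun τ => ¬ τ.SameCycle j i with hs
  let q : Perm ι → ℍ[ℝ] := fun τ =>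
    ((∏ x ∈ (offLeaders α τ j).filter (fun x => ¬ τ.SameCycle i x), (cycleProd M τ x).re : ℝ) :
      ℍ[ℝ])
  -- `F τ` is the term of `τ` without the cycle of `i`; reversing that cycle leaves it unchanged.
  let F : Perm ι → ℍ[ℝ] := fun τ =>
    (((sign τ : ℤˣ) : ℤ) : ℍ[ℝ]) * (cycleProd (M.updateRow j (M i)) τ j * q τ)
  have hsep : ∀ τ ∈ s, (((sign τ : ℤˣ) : ℤ) : ℍ[ℝ]) * (cycleProd (M.updateRow j (M i)) τ j *
      ((∏ x ∈ offLeaders α τ j, (cycleProd M τ x).re : ℝ) : ℍ[ℝ])) =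
      (((cycleProd M τ i).re : ℝ) : ℍ[ℝ]) * F τ := by
    intro τ hτ
    obtain ⟨hτα, hτji⟩ := Finset.mem_filter.1 hτ
    have h1 : ∏ x ∈ offLeaders α τ j, (cycleProd M τ x).re = (cycleProd M τ i).re *
        ∏ x ∈ (offLeaders α τ j).filter (fun x => ¬ τ.SameCycle i x), (cycleProd M τ x).re := by
      have := prod_filter_leaders_eq hτα hi M (fun x => ¬ τ.SameCycle j x)
        fun y hy hc => hτji (hc.trans hy.symm)
      rw [offLeaders, this, offLeaders, Finset.filter_comm]
    rw [h1, Quaternion.coe_mul]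
    simp only [F, q]
    have hc := Quaternion.coe_commutes (cycleProd M τ i).re (cycleProd (M.updateRow j (M i)) τ j)
    rw [← intCast_mul_left_comm]
    congr 1
    rw [← mul_assoc, ← mul_assoc, hc]
  have hjoin : ∀ τ ∈ s, (((sign (τ * swap j i) : ℤˣ) : ℤ) : ℍ[ℝ]) *
      (cycleProd (M.updateRow j (M i)) (τ * swap j i) j *
      ((∏ x ∈ offLeaders α (τ * swap j i) j, (cycleProd M (τ * swap j i) x).re : ℝ) : ℍ[ℝ])) =
      - (cycleProd M τ i * F τ) := by
    intro τ hτ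
    obtain ⟨hτα, hτji⟩ := Finset.mem_filter.1 hτ
    rw [prod_offLeaders_mul_swap M α hτji, cycleProd_mul_swap hτji, Matrix.updateRow_eq_self,
      Perm.sign_mul, sign_swap hij.symm]
    simp only [F, q]
    rw [← intCast_mul_left_comm, mul_assoc (cycleProd M τ i)]
    simp
  -- Multiplication by the transposition matches permutations having `i` and `j` on one cycle with
  -- those separating them, and flips the sign. The joined terms carry the full product through `i`,
  -- the separated ones only its real part; averaging over reversals at `i` makes the two sums
  -- cancel.
  have hbij : ∑ σ ∈ (permsOn α).filter (fun σ => σ.SameCycle j i),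
      (((sign σ : ℤˣ) : ℤ) : ℍ[ℝ]) * (cycleProd (M.updateRow j (M i)) σ j *
      ((∏ x ∈ offLeaders α σ j, (cycleProd M σ x).re : ℝ) : ℍ[ℝ])) =
      ∑ τ ∈ s, - (cycleProd M τ i * F τ) := by
    symm
    refine Finset.sum_nbij' (fun τ => τ * swap j i) (fun σ => σ * swap j i) ?_ ?_ ?_ ?_ ?_
    · intro τ hτ
      obtain ⟨hτα, hτji⟩ := Finset.mem_filter.1 hτ
      exact Finset.mem_filter.2 ⟨mul_swap_mem_permsOn hτα hi hj,
        (sameCycle_mul_swap hτji i).2 (Or.inr (SameCycle.refl _ _))⟩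
    · intro σ hσ
      obtain ⟨hσα, hσji⟩ := Finset.mem_filter.1 hσ
      exact Finset.mem_filter.2 ⟨mul_swap_mem_permsOn hσα hi hj, not_sameCycle_mul_swap hij hσji⟩
    · intro τ _
      simp [mul_assoc]
    · intro τ _
      simp [mul_assoc]
    · intro τ hτ
      exact (hjoin τ hτ).symm
  rw [rowMinor, ← Finset.sum_filter_add_sum_filter_not _ fun σ => σ.SameCycle j i, hbij,
    Finset.sum_congr rfl hsep, ← sum_cycleProd_eq_sum_re hM, Finset.sum_neg_distrib,
    neg_add_cancel]
  · intro τ hτ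
    obtain ⟨hτα, hτji⟩ := Finset.mem_filter.1 hτ
    exact Finset.mem_filter.2 ⟨reverseCycle_mem_permsOn hτα i, by rwa [sameCycle_reverseCycle]⟩
  · intro τ hτ
    obtain ⟨hτα, hτji⟩ := Finset.mem_filter.1 hτ
    simp only [F, q]
    rw [sign_reverseCycle, offLeaders_reverseCycle,
      cycleProd_reverseCycle_of_not_sameCycle _ fun hc => hτji hc.symm]
    simp only [re_cycleProd_reverseCycle hM, sameCycle_reverseCycle]

theorem rowMinor_eq_sum (M : Matrix ι ι ℍ[ℝ]) (α : Finset ι) (j : ι) (b : ι → ℍ[ℝ]) :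
    rowMinor M α j b = ∑ l, b l * rowMinor M α j (Pi.single l 1) := by
  simp only [rowMinor, Finset.mul_sum]
  rw [Finset.sum_comm]
  refine Finset.sum_congr rfl fun σ _ => ?_
  simp only [cycleProd_updateRow]
  rw [Finset.sum_eq_single (σ j)]
  · rw [Pi.single_eq_same, one_mul, mul_assoc, intCast_mul_left_comm]
  · intro l _ hl
    rw [Pi.single_eq_of_ne hl.symm]
    simp
  · simp

theorem rowMinor_single_of_notMem (M : Matrix ι ι ℍ[ℝ]) {α : Finset ι} {j l : ι} (hj : j ∈ α)
    (hl : l ∉ α) : rowMinor M α j (Pi.single l 1) = 0 := by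
  refine Finset.sum_eq_zero fun σ hσ => ?_
  have : σ j ≠ l := by
    rintro rfl
    exact hl ((apply_mem_of_mem_permsOn hσ).2 hj)
  rw [cycleProd_updateRow, Pi.single_eq_of_ne this]
  simp

theorem rowMinor_single_self (M : Matrix ι ι ℍ[ℝ]) (α : Finset ι) (j : ι) :
    rowMinor M α j (Pi.single j 1) = ((minor M (α.erase j) : ℝ) : ℍ[ℝ]) := by
  have hperm : permsOn (α.erase j) = (permsOn α).filter fun σ => σ j = j := by
    ext σ
    simp only [Finset.mem_filter, mem_permsOn, Finset.mem_erase, not_and]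
    constructor
    · intro h
      exact ⟨fun x hx => h x fun _ => hx, h j fun h => absurd rfl h⟩
    · rintro ⟨h1, h2⟩ x hx
      by_cases hxj : x = j
      · rw [hxj, h2]
      · exact h1 x (hx hxj)
  rw [rowMinor, minor, hperm, ← Quaternion.algebraMap_def, map_sum, Finset.sum_filter]
  refine Finset.sum_congr rfl fun σ _ => ?_
  split_ifs with h
  · have hl : leaders (α.erase j) σ = offLeaders α σ j := by
      ext x
      rw [mem_offLeaders, mem_leaders, mem_leaders, Finset.mem_erase]
      have : σ.SameCycle j x ↔ x = j :=
        ⟨fun hs => (hs.eq_of_left h).symm, fun hs => hs ▸ SameCycle.refl _ _⟩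
      rw [this]
      tauto
    rw [hl, cycleProd_eq_apply_of_fixed _ h]
    simpa [Quaternion.algebraMap_def] using Or.inl (Quaternion.coe_intCast _).symm
  · rw [cycleProd_updateRow, Pi.single_eq_of_ne h]
    simp

/-- Only permutations with `σ j = l` survive. Cutting `l` out of their cycle leaves a permutation of
`α.erase l` in which the step out of `j` uses row `l`; the transposition gives the minus sign. -/
theorem rowMinor_single_of_ne (M : Matrix ι ι ℍ[ℝ]) {α : Finset ι} {j l : ι} (hj : j ∈ α)
    (hl : l ∈ α) (hlj : l ≠ j) :
    rowMinor M α j (Pi.single l 1) = - rowMinor M (α.erase l) j (M l) := by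
  have h1 : rowMinor M α j (Pi.single l 1) = ∑ σ ∈ (permsOn α).filter fun σ => σ j = l,
      (((sign σ : ℤˣ) : ℤ) : ℍ[ℝ]) * (cycleProd (M.updateRow j (Pi.single l 1)) σ j *
      ((∏ x ∈ offLeaders α σ j, (cycleProd M σ x).re : ℝ) : ℍ[ℝ])) := by
    rw [rowMinor, Finset.sum_filter]
    refine Finset.sum_congr rfl fun σ _ => ?_
    split_ifs with h
    · rfl
    · rw [cycleProd_updateRow, Pi.single_eq_of_ne h]
      simp
  rw [h1, rowMinor, ← Finset.sum_neg_distrib]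
  symm
  refine Finset.sum_nbij' (fun τ => τ * swap j l) (fun σ => σ * swap j l) ?_ ?_ ?_ ?_ ?_
  · intro τ hτ
    have hτ' := mem_permsOn.1 hτ
    refine Finset.mem_filter.2 ⟨mul_swap_mem_permsOn (mem_permsOn.2 fun x hx => ?_) hl hj, ?_⟩
    · exact hτ' x fun hc => hx (Finset.mem_of_mem_erase hc)
    · simpa using hτ' l (by simp)
  · intro σ hσ
    obtain ⟨hσα, hσj⟩ := Finset.mem_filter.1 hσ
    have h2 := mem_permsOn.1 (mul_swap_mem_permsOn hσα hl hj)
    refine mem_permsOn.2 fun x hx => ?_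
    by_cases hxl : x = l
    · rw [hxl]; simpa using hσj
    · exact h2 x fun hc => hx (Finset.mem_erase.2 ⟨hxl, hc⟩)
  · intro τ _
    simp [mul_assoc]
  · intro τ _
    simp [mul_assoc]
  · intro τ hτ
    have hfix : τ l = l := mem_permsOn.1 hτ l (by simp)
    have hsame : ∀ x, τ.SameCycle l x ↔ x = l := fun x =>
      ⟨fun hs => (hs.eq_of_left hfix).symm, fun hs => hs ▸ SameCycle.refl _ _⟩
    have hτjl : ¬ τ.SameCycle j l := fun hc => hlj ((hsame j).1 hc.symm).symm
    rw [cycleProd_mul_swap hτjl, prod_offLeaders_mul_swap M α hτjl,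
      cycleProd_eq_apply_of_fixed _ hfix, Perm.sign_mul, sign_swap hlj.symm]
    have hset : (offLeaders α τ j).filter (fun x => ¬ τ.SameCycle l x) =
        offLeaders (α.erase l) τ j := by
      ext x
      simp only [Finset.mem_filter, mem_offLeaders, mem_leaders, Finset.mem_erase, hsame]
      tauto
    rw [hset]
    simp

theorem minor_empty (M : Matrix ι ι ℍ[ℝ]) : minor M ∅ = 1 := by
  have : permsOn (∅ : Finset ι) = {1} := by
    ext σ
    simp [mem_permsOn, Equiv.ext_iff]
  rw [minor, this]
  simp [leaders]

end Laplace

theorem hermDet_principal {n : ℕ} {M : Matrix (Fin n) (Fin n) ℍ[ℝ]} (hM : M.IsHermitian)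
    (α : Finset (Fin n)) : hermDet (principal M α) = ((minor M α : ℝ) : ℍ[ℝ]) := by
  rw [hermDet]
  split_ifs with h
  · set j := (Finset.univ : Finset {x // x ∈ α}).min' h
    have := rdet_principal_updateRow hM j.2 (M j)
    rwa [Matrix.updateRow_eq_self, rowMinor_self hM j.2] at this
  · have : α = ∅ := by
      rw [Finset.eq_empty_iff_forall_notMem]
      exact fun x hx => h ⟨⟨x, hx⟩, Finset.mem_univ _⟩
    rw [this, minor_empty, Quaternion.coe_one]

/-! ### Coefficients of the adjugate of `t + M` -/

section Coefficients

variable {n : ℕ}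

/-- The sum of the principal minors of order `s` of `M`. -/
noncomputable def minorSum (s : ℕ) (M : Matrix (Fin n) (Fin n) ℍ[ℝ]) : ℝ :=
  ∑ α ∈ Finset.powersetCard s Finset.univ, minor M α

/-- The sum of the row-replaced minors of order `s` of `M` through `j`. -/
noncomputable def rowMinorSum (s : ℕ) (M : Matrix (Fin n) (Fin n) ℍ[ℝ]) (b : Fin n → ℍ[ℝ])
    (j : Fin n) : ℍ[ℝ] :=
  ∑ α ∈ (Finset.powersetCard s Finset.univ).filter (fun α => j ∈ α), rowMinor M α j b

/-- The coefficient matrices of the adjugate of `t + M` for a Hermitian `M`. -/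
noncomputable def adjCoeff (s : ℕ) (M : Matrix (Fin n) (Fin n) ℍ[ℝ]) :
    Matrix (Fin n) (Fin n) ℍ[ℝ] := fun l j =>
  if l = j then
    ((∑ α ∈ (Finset.powersetCard s Finset.univ).filter (fun α => j ∉ α), minor M α : ℝ) : ℍ[ℝ])
  else
    - ∑ α ∈ (Finset.powersetCard s Finset.univ).filter (fun α => l ∉ α),
      if j ∈ α then rowMinor M α j (M l) else 0

theorem principalMinorSum_eq {M : Matrix (Fin n) (Fin n) ℍ[ℝ]} (hM : M.IsHermitian) (s : ℕ) :
    principalMinorSum s M = ((minorSum s M : ℝ) : ℍ[ℝ]) := by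
  rw [principalMinorSum, minorSum, ← Quaternion.algebraMap_def, map_sum]
  exact Finset.sum_congr rfl fun α _ => hermDet_principal hM α

theorem rowReplacedMinorSum_eq {M : Matrix (Fin n) (Fin n) ℍ[ℝ]} (hM : M.IsHermitian) (s : ℕ)
    (b : Fin n → ℍ[ℝ]) (j : Fin n) :
    rowReplacedMinorSum s M j b = rowMinorSum s M b j := by
  rw [rowReplacedMinorSum, rowMinorSum,
    Finset.sum_subtype (p := fun α : Finset (Fin n) => α.card = s ∧ j ∈ α)]
  · exact Finset.sum_congr rfl fun α _ => rdet_principal_updateRow hM α.2.2 b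
  · simp [Finset.mem_powersetCard]

theorem sum_powersetCard_succ_erase {R : Type*} [AddCommMonoid R] (s : ℕ) (l : Fin n)
    (f : Finset (Fin n) → R) :
    ∑ α ∈ (Finset.powersetCard (s + 1) Finset.univ).filter (fun α => l ∈ α), f (α.erase l) =
      ∑ β ∈ (Finset.powersetCard s Finset.univ).filter (fun β => l ∉ β), f β := by
  refine Finset.sum_nbij' (fun α => α.erase l) (fun β => insert l β) ?_ ?_ ?_ ?_ ?_
  · intro α hα
    simp only [Finset.mem_filter, Finset.mem_powersetCard, Finset.subset_univ, true_and] at hα ⊢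
    exact ⟨by rw [Finset.card_erase_of_mem hα.2, hα.1]; rfl, by simp⟩
  · intro β hβ
    simp only [Finset.mem_filter, Finset.mem_powersetCard, Finset.subset_univ, true_and] at hβ ⊢
    exact ⟨by rw [Finset.card_insert_of_notMem hβ.2, hβ.1], by simp⟩
  · intro α hα
    exact Finset.insert_erase (Finset.mem_filter.1 hα).2
  · intro β hβ
    exact Finset.erase_insert (Finset.mem_filter.1 hβ).2
  · intro α _
    rfl

/-- Expansion of the row-replaced minor sums along the replaced row. -/
theorem rowMinorSum_succ (s : ℕ) (M : Matrix (Fin n) (Fin n) ℍ[ℝ]) (b : Fin n → ℍ[ℝ])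
    (j : Fin n) : rowMinorSum (s + 1) M b j = ∑ l, b l * adjCoeff s M l j := by
  rw [rowMinorSum, Finset.sum_congr rfl fun α _ => rowMinor_eq_sum M α j b, Finset.sum_comm]
  refine Finset.sum_congr rfl fun l _ => ?_
  rw [← Finset.mul_sum]
  congr 1
  by_cases hl : l = j
  · subst hl
    rw [adjCoeff, if_pos rfl, ← sum_powersetCard_succ_erase, ← Quaternion.algebraMap_def, map_sum]
    exact Finset.sum_congr rfl fun α _ => rowMinor_single_self M α l
  · rw [adjCoeff, if_neg hl, ← sum_powersetCard_succ_erase, ← Finset.sum_neg_distrib,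
      Finset.sum_filter, Finset.sum_filter]
    refine Finset.sum_congr rfl fun α _ => ?_
    by_cases hj : j ∈ α
    · by_cases hlα : l ∈ α
      · rw [if_pos hj, if_pos hlα, if_pos (Finset.mem_erase.2 ⟨fun h => hl h.symm, hj⟩)]
        exact rowMinor_single_of_ne M hj hlα hl
      · simp [hj, hlα, rowMinor_single_of_notMem M hj hlα]
    · simp [hj]

/-- For `i ≠ j`, sets containing `i` give a repeated row, hence zero, and the other sets cancel
against `adjCoeff`. For `i = j`, the two terms split the principal minors by whether they contain
`j`. -/
theorem rowMinorSum_row_add_adjCoeff {M : Matrix (Fin n) (Fin n) ℍ[ℝ]} (hM : M.IsHermitian)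
    (s : ℕ) (i j : Fin n) : rowMinorSum s M (M i) j + adjCoeff s M i j =
      if i = j then ((minorSum s M : ℝ) : ℍ[ℝ]) else 0 := by
  by_cases hij : i = j
  · subst hij
    rw [adjCoeff, if_pos rfl, if_pos rfl, rowMinorSum, minorSum,
      ← Finset.sum_filter_add_sum_filter_not (Finset.powersetCard s Finset.univ)
        (fun α => i ∈ α) (minor M), Quaternion.coe_add]
    congr 1
    rw [← Quaternion.algebraMap_def, map_sum]
    exact Finset.sum_congr rfl fun α hα => rowMinor_self hM (Finset.mem_filter.1 hα).2
  · rw [adjCoeff, if_neg hij, if_neg hij, rowMinorSum, Finset.sum_filter, Finset.sum_filter,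
      ← Finset.sum_neg_distrib, ← Finset.sum_add_distrib]
    refine Finset.sum_eq_zero fun α _ => ?_
    by_cases hj : j ∈ α
    · by_cases hi : i ∈ α
      · simp [hj, hi, rowMinor_row_of_ne hM hi hj hij]
      · simp [hj, hi]
    · simp [hj]

/-- The Faddeev–LeVerrier recursion. -/
theorem mul_adjCoeff_add_adjCoeff_succ {M : Matrix (Fin n) (Fin n) ℍ[ℝ]} (hM : M.IsHermitian)
    (s : ℕ) : M * adjCoeff s M + adjCoeff (s + 1) M =
      minorSum (s + 1) M • (1 : Matrix (Fin n) (Fin n) ℍ[ℝ]) := by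
  ext1 i j
  rw [Matrix.add_apply, Matrix.mul_apply, ← rowMinorSum_succ, rowMinorSum_row_add_adjCoeff hM,
    Matrix.smul_apply, Matrix.one_apply]
  split_ifs
  · rw [← Quaternion.coe_one, ← Quaternion.coe_smul]; simp
  · simp

theorem minorSum_zero (M : Matrix (Fin n) (Fin n) ℍ[ℝ]) : minorSum 0 M = 1 := by
  simp [minorSum, minor_empty]

theorem adjCoeff_zero (M : Matrix (Fin n) (Fin n) ℍ[ℝ]) : adjCoeff 0 M = 1 := by
  ext1 l j
  rw [adjCoeff, Matrix.one_apply]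
  split_ifs with h
  · simp [Finset.filter_singleton, minor_empty]
  · simp [Finset.filter_singleton]

/-- No index lies outside the full set. This terminates the recursion and plays the role of
Cayley–Hamilton. -/
theorem adjCoeff_card (M : Matrix (Fin n) (Fin n) ℍ[ℝ]) : adjCoeff n M = 0 := by
  have h : Finset.powersetCard n (Finset.univ : Finset (Fin n)) = {Finset.univ} := by
    have := Finset.powersetCard_self (Finset.univ : Finset (Fin n))
    rwa [Finset.card_fin] at this
  ext1 l j
  rw [adjCoeff, h]
  split_ifs <;> simp [Finset.filter_singleton]

theorem minorSum_eq_zero_of_lt (M : Matrix (Fin n) (Fin n) ℍ[ℝ]) {s : ℕ} (h : n < s) :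
    minorSum s M = 0 := by
  rw [minorSum, Finset.powersetCard_eq_empty.2 (by simpa using h), Finset.sum_empty]

theorem rowMinorSum_zero (M : Matrix (Fin n) (Fin n) ℍ[ℝ]) (b : Fin n → ℍ[ℝ]) (j : Fin n) :
    rowMinorSum 0 M b j = 0 := by
  simp [rowMinorSum, Finset.filter_singleton]

/-- By the recursion, the coefficients are polynomials in `M` with real, hence central,
coefficients. -/
theorem commute_adjCoeff {M N : Matrix (Fin n) (Fin n) ℍ[ℝ]} (hM : M.IsHermitian)
    (h : Commute N M) (s : ℕ) : Commute N (adjCoeff s M) := by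
  induction s with
  | zero => rw [adjCoeff_zero]; exact Commute.one_right N
  | succ s ih =>
    rw [eq_sub_of_add_eq' (mul_adjCoeff_add_adjCoeff_succ hM s)]
    exact ((Commute.one_right N).smul_right _).sub_right (h.mul_right ih)

/-- Each set of size `s` is counted once for every index outside it. -/
theorem sum_re_adjCoeff_diag (s : ℕ) (M : Matrix (Fin n) (Fin n) ℍ[ℝ]) :
    ∑ j, (adjCoeff s M j j).re = ((n : ℝ) - s) * minorSum s M := by
  simp only [adjCoeff, if_true, Quaternion.re_coe, Finset.sum_filter]
  rw [Finset.sum_comm, minorSum, Finset.mul_sum]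
  refine Finset.sum_congr rfl fun α hα => ?_
  rw [← Finset.sum_filter, Finset.sum_const, nsmul_eq_mul]
  congr 1
  have h1 : (Finset.univ.filter fun j => j ∉ α) = αᶜ := by ext; simp
  have h2 := (Finset.mem_powersetCard.1 hα).2
  rw [h1, Finset.card_compl, Fintype.card_fin, h2, Nat.cast_sub]
  rw [← h2]
  simpa using Finset.card_le_univ α

/-! ### Powers of Hermitian matrices -/

/-- Pairing with `v` gives the sum of the squared norms of the entries of `N v`. -/
theorem mulVec_eq_zero_of_conjTranspose_mul_mulVec {m : ℕ} (N : Matrix (Fin m) (Fin n) ℍ[ℝ])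
    (v : Fin n → ℍ[ℝ]) (h : (N.conjTranspose * N).mulVec v = 0) : N.mulVec v = 0 := by
  have h1 : star v ⬝ᵥ (N.conjTranspose * N).mulVec v = 0 := by rw [h]; simp
  rw [← Matrix.mulVec_mulVec, Matrix.dotProduct_mulVec, ← Matrix.star_mulVec] at h1
  have h2 : ∑ i, Quaternion.normSq (N.mulVec v i) = 0 := by
    have h3 := congrArg QuaternionAlgebra.re h1
    rw [dotProduct] at h3
    simp only [Pi.star_apply, Quaternion.star_mul_self] at h3
    rw [← Quaternion.algebraMap_def, ← map_sum] at h3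
    simpa only [Quaternion.algebraMap_def, Quaternion.re_coe, Quaternion.re_zero] using h3
  funext i
  have := (Finset.sum_eq_zero_iff_of_nonneg fun i _ => Quaternion.normSq_nonneg).1 h2 i
    (Finset.mem_univ _)
  exact Quaternion.normSq_eq_zero.1 this

theorem mulVec_eq_zero_of_pow_mulVec {M : Matrix (Fin n) (Fin n) ℍ[ℝ]} (hM : M.IsHermitian)
    (t : ℕ) (v : Fin n → ℍ[ℝ]) (h : (M ^ (t + 1)).mulVec v = 0) : M.mulVec v = 0 := by
  induction t with
  | zero => simpa using h
  | succ t ih =>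
    apply ih
    have h2 : M.conjTranspose * M = M ^ 2 := by rw [hM.eq, sq]
    rw [pow_succ', ← Matrix.mulVec_mulVec]
    apply mulVec_eq_zero_of_conjTranspose_mul_mulVec
    rw [h2, Matrix.mulVec_mulVec, ← pow_add, add_comm 2 t]
    exact h

theorem mul_eq_zero_of_forall_mulVec {m p : ℕ} {M M' : Matrix (Fin m) (Fin n) ℍ[ℝ]}
    (hMM : ∀ v, M.mulVec v = 0 → M'.mulVec v = 0)
    {Y : Matrix (Fin n) (Fin p) ℍ[ℝ]} (h : M * Y = 0) : M' * Y = 0 := by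
  ext1 i j
  have h1 : M.mulVec (fun l => Y l j) = 0 := funext fun i => congrFun (congrFun h i) j
  exact congrFun (hMM _ h1) i

/-- The order of the largest nonzero minor sum of a Hermitian matrix `M`, together with an
inverse of `M` on its range that is expressed by the adjugate coefficients. -/
theorem exists_minorSum_ne_zero {M : Matrix (Fin n) (Fin n) ℍ[ℝ]} (hM : M.IsHermitian) :
    ∃ (q : ℕ) (G : Matrix (Fin n) (Fin n) ℍ[ℝ]), minorSum q M ≠ 0 ∧
      (∀ N, Commute N M → Commute N G) ∧ M * (1 - M * G) = 0 ∧
      ∑ j, ((1 - M * G) j j).re = (n : ℝ) - q ∧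
      ∀ b j, rowMinorSum q M b j = ((minorSum q M : ℝ) : ℍ[ℝ]) * ∑ l, b l * G l j := by
  classical
  set q := Nat.findGreatest (fun s => minorSum s M ≠ 0) n with hq
  have hqn : q ≤ n := Nat.findGreatest_le n
  have hq0 : minorSum q M ≠ 0 :=
    Nat.findGreatest_spec (P := fun s => minorSum s M ≠ 0) (Nat.zero_le n)
      (by simp [minorSum_zero])
  have hgt : ∀ s, q < s → minorSum s M = 0 := by
    intro s hs
    by_contra hne
    rcases le_or_gt s n with h | h
    · exact Nat.findGreatest_is_greatest hs h hne
    · exact hne (minorSum_eq_zero_of_lt M h)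
  -- Beyond `q` the minor sums vanish, so the recursion becomes multiplication by `-M`.
  have hpow : ∀ t, adjCoeff (q + t) M = (-1) ^ t * (M ^ t * adjCoeff q M) := by
    intro t
    induction t with
    | zero => simp
    | succ t ih =>
      have := mul_adjCoeff_add_adjCoeff_succ hM (q + t)
      rw [hgt _ (by omega), zero_smul] at this
      rw [← add_assoc, eq_neg_of_add_eq_zero_right this, ih, pow_succ' M, pow_succ', mul_assoc,
        mul_assoc M]
      have hc : Commute M ((-1) ^ t) := (Commute.neg_one_right M).pow_right t
      rw [← mul_assoc M, hc.eq, mul_assoc]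
      simp
  -- Running up to order `n` gives `M ^ (n - q) * adjCoeff q M = 0`; a Hermitian matrix kills
  -- whatever a positive power of it kills.
  have hMC : M * adjCoeff q M = 0 := by
    obtain ⟨t, ht⟩ := Nat.exists_eq_add_of_le hqn
    have h0 : adjCoeff (q + t) M = 0 := by rw [← ht]; exact adjCoeff_card M
    rw [hpow] at h0
    have h1 : M ^ t * adjCoeff q M = 0 := (isUnit_one.neg.pow t).mul_right_eq_zero.1 h0
    have h2 : M ^ (t + 1) * adjCoeff q M = 0 := by rw [pow_succ', mul_assoc, h1, mul_zero]
    exact mul_eq_zero_of_forall_mulVec (fun v => mulVec_eq_zero_of_pow_mulVec hM t v) h2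
  -- `G` is `adjCoeff (q - 1) M` divided by the minor sum of order `q`. For `q = 0` there is no such
  -- coefficient and `G = 0` serves.
  obtain ⟨G, hG, hPG, hR⟩ : ∃ G : Matrix (Fin n) (Fin n) ℍ[ℝ],
      (∀ N, Commute N M → Commute N G) ∧ adjCoeff q M = minorSum q M • (1 - M * G) ∧
      ∀ b j, rowMinorSum q M b j = ((minorSum q M : ℝ) : ℍ[ℝ]) * ∑ l, b l * G l j := by
    clear_value q
    cases q with
    | zero =>
      refine ⟨0, fun N _ => Commute.zero_right N, ?_, ?_⟩
      · simp [adjCoeff_zero, minorSum_zero]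
      · simp [rowMinorSum_zero]
    | succ p =>
      refine ⟨(minorSum (p + 1) M)⁻¹ • adjCoeff p M,
        fun N hN => (commute_adjCoeff hM hN p).smul_right _, ?_, ?_⟩
      · rw [Matrix.mul_smul, smul_sub, smul_smul, mul_inv_cancel₀ hq0, one_smul,
          ← mul_adjCoeff_add_adjCoeff_succ hM, add_sub_cancel_left]
      · intro b j
        rw [rowMinorSum_succ, Finset.mul_sum]
        refine Finset.sum_congr rfl fun l _ => ?_
        rw [Matrix.smul_apply, mul_smul_comm, Quaternion.coe_mul_eq_smul, smul_smul,
          mul_inv_cancel₀ hq0, one_smul]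
  refine ⟨q, G, hq0, hG, ?_, ?_, hR⟩
  · have : minorSum q M • (M * (1 - M * G)) = 0 := by rw [← Matrix.mul_smul, ← hPG, hMC]
    exact (smul_eq_zero.1 this).resolve_left hq0
  · have h1 := sum_re_adjCoeff_diag q M
    rw [hPG] at h1
    simp only [Matrix.smul_apply, Quaternion.re_smul, smul_eq_mul] at h1
    rw [← Finset.mul_sum, mul_comm] at h1
    exact mul_right_cancel₀ hq0 h1

end Coefficients

/-! ### Rank and index -/

section Rank

variable {m n : ℕ}

/-- Multiplication of column vectors by a quaternion matrix, as a real linear map. -/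
noncomputable def mulVecReal (M : Matrix (Fin m) (Fin n) ℍ[ℝ]) :
    (Fin n → ℍ[ℝ]) →ₗ[ℝ] (Fin m → ℍ[ℝ]) where
  toFun v := M.mulVec v
  map_add' v w := Matrix.mulVec_add M v w
  map_smul' c v := Matrix.mulVec_smul M c v

@[simp]
theorem mulVecReal_apply (M : Matrix (Fin m) (Fin n) ℍ[ℝ]) (v : Fin n → ℍ[ℝ]) :
    mulVecReal M v = M.mulVec v := rfl

/-- Over the reals, the range of `M` is its right column space, and `ℍ` has real dimension 4. This
brings real rank–nullity and traces into play. -/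
theorem finrank_range_mulVecReal (M : Matrix (Fin m) (Fin n) ℍ[ℝ]) :
    Module.finrank ℝ (LinearMap.range (mulVecReal M)) = 4 * rank M := by
  set S := Submodule.span (ℍ[ℝ])ᵐᵒᵖ (Set.range fun (j : Fin n) (i : Fin m) => M i j) with hS
  have h1 : LinearMap.range (mulVecReal M) = S.restrictScalars ℝ := by
    ext x
    rw [LinearMap.mem_range, Submodule.restrictScalars_mem, hS,
      Submodule.mem_span_range_iff_exists_fun]
    constructor
    · rintro ⟨v, rfl⟩
      refine ⟨fun j => MulOpposite.op (v j), ?_⟩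
      funext i
      simp [Matrix.mulVec, dotProduct]
    · rintro ⟨c, rfl⟩
      refine ⟨fun j => (c j).unop, ?_⟩
      funext i
      simp [Matrix.mulVec, dotProduct]
  have h2 : Module.finrank ℝ (S.restrictScalars ℝ) = Module.finrank ℝ S := rfl
  rw [h1, h2, ← Module.finrank_mul_finrank ℝ (ℍ[ℝ])ᵐᵒᵖ S, MulOpposite.finrank,
    Quaternion.finrank_eq_four]
  rfl

theorem finrank_vec : Module.finrank ℝ (Fin n → ℍ[ℝ]) = 4 * n := by
  rw [Module.finrank_pi_fintype]
  simp [Quaternion.finrank_eq_four, mul_comm]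

theorem four_rank_add_finrank_ker (M : Matrix (Fin m) (Fin n) ℍ[ℝ]) :
    4 * rank M + Module.finrank ℝ (LinearMap.ker (mulVecReal M)) = 4 * n := by
  rw [← finrank_range_mulVecReal, LinearMap.finrank_range_add_finrank_ker, finrank_vec]

theorem ker_mulVecReal_pow_le (T : Matrix (Fin n) (Fin n) ℍ[ℝ]) (k : ℕ) :
    LinearMap.ker (mulVecReal (T ^ k)) ≤ LinearMap.ker (mulVecReal (T ^ (k + 1))) := by
  intro v hv
  rw [LinearMap.mem_ker, mulVecReal_apply] at hv ⊢
  rw [pow_succ', ← Matrix.mulVec_mulVec, hv, Matrix.mulVec_zero]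

theorem ker_mulVecReal_pow_succ {T : Matrix (Fin n) (Fin n) ℍ[ℝ]} {k : ℕ}
    (h : rank (T ^ (k + 1)) = rank (T ^ k)) :
    LinearMap.ker (mulVecReal (T ^ (k + 1))) = LinearMap.ker (mulVecReal (T ^ k)) := by
  refine (Submodule.eq_of_le_of_finrank_eq (ker_mulVecReal_pow_le T k) ?_).symm
  have h1 := four_rank_add_finrank_ker (T ^ (k + 1))
  have h2 := four_rank_add_finrank_ker (T ^ k)
  omega

theorem pow_mulVec_eq_zero {T : Matrix (Fin n) (Fin n) ℍ[ℝ]} {k : ℕ}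
    (h : rank (T ^ (k + 1)) = rank (T ^ k)) {v : Fin n → ℍ[ℝ]}
    (hv : (T ^ (k + 1)).mulVec v = 0) : (T ^ k).mulVec v = 0 := by
  have : v ∈ LinearMap.ker (mulVecReal (T ^ (k + 1))) := hv
  rw [ker_mulVecReal_pow_succ h] at this
  exact this

theorem rank_pow_succ_le (T : Matrix (Fin n) (Fin n) ℍ[ℝ]) (k : ℕ) :
    rank (T ^ (k + 1)) ≤ rank (T ^ k) := by
  have h1 := four_rank_add_finrank_ker (T ^ (k + 1))
  have h2 := four_rank_add_finrank_ker (T ^ k)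
  have h3 := Submodule.finrank_mono (ker_mulVecReal_pow_le T k)
  omega

/-- Ranks of powers cannot decrease strictly forever, so the infimum is attained and is not the
default value for the empty set. -/
theorem rank_pow_ind_succ (T : Matrix (Fin n) (Fin n) ℍ[ℝ]) :
    rank (T ^ (ind T + 1)) = rank (T ^ ind T) := by
  have hne : {k : ℕ | rank (T ^ (k + 1)) = rank (T ^ k)}.Nonempty := by
    by_contra hc
    rw [Set.not_nonempty_iff_eq_empty, Set.eq_empty_iff_forall_notMem] at hc
    have hdec : ∀ k, rank (T ^ k) + k ≤ rank (T ^ 0) := by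
      intro k
      induction k with
      | zero => rfl
      | succ k ih =>
        have h1 := rank_pow_succ_le T k
        have h2 : rank (T ^ (k + 1)) ≠ rank (T ^ k) := hc k
        omega
    have := hdec (rank (T ^ 0) + 1)
    omega
  exact Nat.sInf_mem hne

theorem pow_mulVec_eq_zero_of_ind_le {T : Matrix (Fin n) (Fin n) ℍ[ℝ]} {k : ℕ}
    (hk : ind T ≤ k) {v : Fin n → ℍ[ℝ]} (hv : (T ^ (k + 1)).mulVec v = 0) :
    (T ^ k).mulVec v = 0 := by
  obtain ⟨t, rfl⟩ := Nat.exists_eq_add_of_le hk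
  rw [pow_add, ← Matrix.mulVec_mulVec]
  refine pow_mulVec_eq_zero (rank_pow_ind_succ T) ?_
  rw [Matrix.mulVec_mulVec, ← pow_add, Nat.add_right_comm]
  exact hv

/-- Left multiplication by a quaternion `a` has real trace `4 * a.re`. -/
theorem trace_mulVecReal (P : Matrix (Fin n) (Fin n) ℍ[ℝ]) :
    LinearMap.trace ℝ _ (mulVecReal P) = 4 * ∑ j, (P j j).re := by
  classical
  let e : Module.Basis (Fin 4) ℝ ℍ[ℝ] := QuaternionAlgebra.basisOneIJK (-1 : ℝ) 0 (-1)
  have he : ∀ (c : Fin 4) (a : ℍ[ℝ]), e.repr a c = ![a.re, a.imI, a.imJ, a.imK] c := fun _ _ => rfl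
  have hb : ∀ a : ℍ[ℝ], ∑ c, e.repr (a * e c) c = 4 * a.re := by
    intro a
    have hre : ∀ c d : Fin 4, ![(e c).re, (e c).imI, (e c).imJ, (e c).imK] d =
        if c = d then 1 else 0 := by
      intro c d
      rw [← he, Module.Basis.repr_self, Finsupp.single_apply]
    have r := fun c => hre c 0
    have i := fun c => hre c 1
    have j := fun c => hre c 2
    have k := fun c => hre c 3
    simp only [Matrix.cons_val] at r i j k
    simp only [he, Fin.sum_univ_four, Matrix.cons_val, Quaternion.re_mul, Quaternion.imI_mul,
      Quaternion.imJ_mul, Quaternion.imK_mul, r, i, j, k]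
    simp
    ring
  rw [LinearMap.trace_eq_matrix_trace ℝ (Pi.basis fun _ : Fin n => e), Matrix.trace,
    Fintype.sum_sigma, Finset.mul_sum]
  refine Finset.sum_congr rfl fun j _ => ?_
  rw [← hb]
  refine Finset.sum_congr rfl fun c _ => ?_
  rw [Matrix.diag_apply, LinearMap.toMatrix_apply, Pi.basis_apply, Pi.basis_repr,
    mulVecReal_apply, Matrix.mulVec_single]
  simp

/-- The rank of a matrix from the trace of the projection onto its kernel. -/
theorem rank_eq_of_mul_one_sub {M G : Matrix (Fin n) (Fin n) ℍ[ℝ]} {q : ℕ}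
    (hMG : Commute M G) (h : M * (1 - M * G) = 0)
    (htr : ∑ j, ((1 - M * G) j j).re = (n : ℝ) - q) : rank M = q := by
  have hproj : LinearMap.IsProj (LinearMap.ker (mulVecReal M)) (mulVecReal (1 - M * G)) := by
    constructor
    · intro v
      rw [LinearMap.mem_ker, mulVecReal_apply, mulVecReal_apply, Matrix.mulVec_mulVec, h,
        Matrix.zero_mulVec]
    · intro v hv
      have hv' : M.mulVec v = 0 := hv
      rw [mulVecReal_apply, Matrix.sub_mulVec, Matrix.one_mulVec, hMG.eq, ← Matrix.mulVec_mulVec,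
        hv', Matrix.mulVec_zero, sub_zero]
  have h1 := hproj.trace
  rw [trace_mulVecReal, htr] at h1
  have h2 := four_rank_add_finrank_ker M
  have h3 : (4 * rank M + Module.finrank ℝ (LinearMap.ker (mulVecReal M)) : ℝ) = 4 * n := by
    exact_mod_cast h2
  have h4 : (rank M : ℝ) = q := by linarith
  exact_mod_cast h4

end Rank

/-! ### The weighted Drazin inverse -/

/-- Uniqueness of the Drazin inverse in a ring. -/
theorem drazin_unique {R : Type*} [Ring R] {T D E : R} {k : ℕ} (hD : T ^ (k + 1) * D = T ^ k)
    (hDo : D * T * D = D) (hDc : T * D = D * T) (hE : T ^ (k + 1) * E = T ^ k)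
    (hEo : E * T * E = E) (hEc : T * E = E * T) : D = E := by
  have pw : ∀ {F : R}, F * T * F = F → T * F = F * T → ∀ t : ℕ, F = T ^ t * F ^ (t + 1) := by
    intro F ho hc t
    induction t with
    | zero => simp
    | succ t ih =>
      have hF : F ^ (t + 1) = T * F ^ (t + 2) := by
        have : T * F * F = F := by rw [hc, ho]
        rw [pow_succ' F (t + 1), pow_succ' F t, ← mul_assoc, ← mul_assoc, this]
      rw [pow_succ, mul_assoc, ← hF]
      exact ih
  -- Write `F = T ^ k * F ^ (k + 1)` and absorb `T ^ k = H * T ^ (k + 1)`.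
  have key : ∀ {F H : R}, T ^ (k + 1) * H = T ^ k → F * T * F = F → T * F = F * T →
      T * H = H * T → F = H * T * F := by
    intro F H hH ho hc hcH
    have h1 := pw ho hc k
    have hcH' : T ^ (k + 1) * H = H * T ^ (k + 1) := (Commute.pow_left hcH (k + 1)).eq
    calc F = T ^ k * F ^ (k + 1) := h1
      _ = H * T ^ (k + 1) * F ^ (k + 1) := by rw [← hcH', hH]
      _ = H * T * (T ^ k * F ^ (k + 1)) := by rw [pow_succ']; simp only [mul_assoc]
      _ = H * T * F := by rw [← h1]
  have hD1 := key hE hDo hDc hEc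
  have hDT : ∀ t, D = D ^ (t + 1) * T ^ t := fun t => by
    rw [(Commute.pow_pow (show Commute D T from hDc.symm) (t + 1) t).eq]
    exact pw hDo hDc t
  have hE1 := key hD hEo hEc hDc
  have hcc : E * T * D = D * T * E := by
    have hEk := pw hEo hEc k
    calc E * T * D = E ^ (k + 1) * T ^ k * T * D := by
          conv_lhs => rw [hEk]
          rw [(Commute.pow_pow (show Commute E T from hEc.symm) (k + 1) k).eq]
      _ = E ^ (k + 1) * (T ^ (k + 1) * D) := by rw [pow_succ T k]; simp only [mul_assoc]
      _ = E := by
          rw [hD, (Commute.pow_pow (show Commute E T from hEc.symm) (k + 1) k).eq, ← hEk]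
      _ = D * T * E := hE1
  rw [hD1, hcc, ← hE1]

/-- For a solution `Z`, the product `Z * W` is the ordinary Drazin inverse of `A * W`, and `Z` is
recovered as `(Z * W) ^ 2 * A`. -/
theorem IsWeightedDrazin.unique {m n : ℕ} {A : Matrix (Fin m) (Fin n) ℍ[ℝ]}
    {W : Matrix (Fin n) (Fin m) ℍ[ℝ]} {X Y : Matrix (Fin m) (Fin n) ℍ[ℝ]}
    (hX : IsWeightedDrazin A W X) (hY : IsWeightedDrazin A W Y) : Y = X := by
  have outer : ∀ {Z : Matrix (Fin m) (Fin n) ℍ[ℝ]}, IsWeightedDrazin A W Z →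
      (Z * W) * (A * W) * (Z * W) = Z * W := fun {Z} hZ => by
    conv_rhs => rw [← hZ.outer]
    simp only [Matrix.mul_assoc]
  have comm : ∀ {Z : Matrix (Fin m) (Fin n) ℍ[ℝ]}, IsWeightedDrazin A W Z →
      (A * W) * (Z * W) = (Z * W) * (A * W) := fun {Z} hZ => by
    have := congrArg (fun Q => Q * W) hZ.comm
    simpa only [Matrix.mul_assoc] using this
  have recover : ∀ {Z : Matrix (Fin m) (Fin n) ℍ[ℝ]}, IsWeightedDrazin A W Z →
      Z = (Z * W) * (Z * W) * A := fun {Z} hZ => by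
    conv_lhs => rw [← hZ.outer]
    have := congrArg (fun Q => Z * W * Q) hZ.comm
    simpa only [Matrix.mul_assoc] using this
  have hD : Y * W = X * W := by
    refine drazin_unique ?_ (outer hY) (comm hY) ?_ (outer hX) (comm hX)
      (k := max (ind (A * W)) (ind (W * A)))
    · simpa only [Matrix.mul_assoc] using hY.pow_eq
    · simpa only [Matrix.mul_assoc] using hX.pow_eq
  rw [recover hY, recover hX, hD]

theorem mul_pow_mul_comm {m n : ℕ} (A : Matrix (Fin m) (Fin n) ℍ[ℝ])
    (W : Matrix (Fin n) (Fin m) ℍ[ℝ]) (t : ℕ) : (A * W) ^ t * A = A * (W * A) ^ t := by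
  induction t with
  | zero => simp
  | succ t ih => rw [pow_succ, pow_succ', Matrix.mul_assoc, Matrix.mul_assoc A W A,
      ← Matrix.mul_assoc _ A, ih, Matrix.mul_assoc, ← pow_succ, pow_succ']

end QuatMat

/-- If `W * A` is Hermitian, the `W`-weighted Drazin inverse `X` of `A` (which exists and is
unique) has entries given by row determinants, the denominator being nonzero. -/
theorem theorem3p7 {m n : ℕ} (A : Matrix (Fin m) (Fin n) ℍ[ℝ]) (W : Matrix (Fin n) (Fin m) ℍ[ℝ])
    (hU : (W * A).IsHermitian) (k r : ℕ)
    (hk : k = max (QuatMat.ind (A * W)) (QuatMat.ind (W * A)))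
    (hr₁ : QuatMat.rank ((W * A) ^ (k + 1)) = r) (hr₂ : QuatMat.rank ((W * A) ^ k) = r) :
    ∃ X : Matrix (Fin m) (Fin n) ℍ[ℝ],
      QuatMat.IsWeightedDrazin A W X ∧
      (∀ Y, QuatMat.IsWeightedDrazin A W Y → Y = X) ∧
      QuatMat.principalMinorSum r ((W * A) ^ (k + 2)) ≠ 0 ∧
      ∀ i j, X i j =
        QuatMat.rowReplacedMinorSum r ((W * A) ^ (k + 2)) j ((A * (W * A) ^ k) i) /
          QuatMat.principalMinorSum r ((W * A) ^ (k + 2)) := by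
  open QuatMat in
  set B := W * A with hB
  have hM : (B ^ (k + 2)).IsHermitian := hU.pow (k + 2)
  obtain ⟨q, G, hq0, hGc, hMG, htr, hrow⟩ := exists_minorSum_ne_zero hM
  have hBG : Commute B G := hGc B (Commute.self_pow B _)
  have hker : ∀ v, (B ^ (k + 2)).mulVec v = 0 → (B ^ k).mulVec v = 0 := by
    intro v hv
    have h1 : rank (B ^ (k + 1)) = rank (B ^ k) := by rw [hr₁, hr₂]
    refine pow_mulVec_eq_zero h1 ?_
    rw [pow_succ, ← Matrix.mulVec_mulVec]
    refine pow_mulVec_eq_zero h1 ?_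
    rw [Matrix.mulVec_mulVec, ← pow_succ]
    exact hv
  -- `q` is the rank of `B ^ (k + 2)`, and the kernels of the powers of `B` are stable from exponent
  -- `k` on.
  have hqr : q = r := by
    rw [← rank_eq_of_mul_one_sub (hBG.pow_left _) hMG htr, ← hr₂]
    have h1 := four_rank_add_finrank_ker (B ^ (k + 2))
    have h2 := four_rank_add_finrank_ker (B ^ k)
    have h3 : LinearMap.ker (mulVecReal (B ^ (k + 2))) = LinearMap.ker (mulVecReal (B ^ k)) :=
      le_antisymm (fun v hv => hker v hv)
        ((ker_mulVecReal_pow_le B k).trans (ker_mulVecReal_pow_le B (k + 1)))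
    rw [h3] at h1
    omega
  subst hqr
  -- The columns of `1 - M * G` lie in the kernel of `M = B ^ (k + 2)`, hence in that of `B ^ k`.
  have hBk : B ^ (2 * k + 2) * G = B ^ k := by
    have := mul_eq_zero_of_forall_mulVec hker hMG
    rw [mul_sub, mul_one, ← mul_assoc, ← pow_add] at this
    rw [show 2 * k + 2 = k + (k + 2) by omega]
    exact (sub_eq_zero.1 this).symm
  have hX : IsWeightedDrazin A W (A * B ^ k * G) := by
    constructor
    · rw [← hk]
      -- The desired equation is proved with one extra factor `A * W`, which supplies the exponent
      -- `2 * k + 2` of `hBk`. The factor is then cancelled because the index of `A * W` is at most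
      -- `k`.
      have hT : (A * W) * ((A * W) ^ (k + 1) * (A * B ^ k * G) * W) = (A * W) ^ (k + 1) := by
        have h1 : (A * W) ^ (k + 1 + 1) * A = A * B ^ (k + 1 + 1) := mul_pow_mul_comm A W _
        calc (A * W) * ((A * W) ^ (k + 1) * (A * B ^ k * G) * W)
            = ((A * W) ^ (k + 1 + 1) * A) * B ^ k * G * W := by
              rw [pow_succ' _ (k + 1)]; simp only [Matrix.mul_assoc]
          _ = A * (B ^ (2 * k + 2) * G) * W := by
              rw [h1, Matrix.mul_assoc A, ← pow_add, Matrix.mul_assoc A,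
                show k + 1 + 1 + k = 2 * k + 2 by omega]
          _ = (A * W) ^ (k + 1) := by
              rw [hBk, ← mul_pow_mul_comm, pow_succ, Matrix.mul_assoc]
      have hz : (A * W) ^ (k + 1) * (A * W * (A * B ^ k * G * W) - 1) = 0 := by
        rw [mul_sub, mul_one, sub_eq_zero]
        conv_rhs => rw [← hT]
        simp only [← Matrix.mul_assoc]
        rw [Matrix.mul_assoc _ A W, ← pow_succ, ← pow_succ']
      have hz' := mul_eq_zero_of_forall_mulVec (M' := (A * W) ^ k)
        (fun v hv => pow_mulVec_eq_zero_of_ind_le (by rw [hk]; exact le_max_left _ _) hv) hz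
      rw [mul_sub, mul_one, sub_eq_zero] at hz'
      conv_rhs => rw [← hz']
      rw [pow_succ]
      simp only [Matrix.mul_assoc]
    · have h1 : A * B ^ k * G * W * A * W * (A * B ^ k * G) =
          A * (B ^ k * (G * (B ^ (k + 2) * G))) := by
        rw [show k + 2 = 1 + 1 + k by omega, pow_add B (1 + 1), pow_add, pow_one, hB]
        simp only [Matrix.mul_assoc]
      rw [h1, ← Matrix.mul_assoc G, ← (hBG.pow_left (k + 2)).eq, ← Matrix.mul_assoc (B ^ k),
        ← Matrix.mul_assoc (B ^ k), ← pow_add, show k + (k + 2) = 2 * k + 2 by omega, hBk,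
        Matrix.mul_assoc]
    · have h1 : A * W * (A * B ^ k * G) = A * (B * B ^ k * G) := by
        rw [hB]; simp only [Matrix.mul_assoc]
      have h2 : A * B ^ k * G * W * A = A * (B ^ k * (G * B)) := by
        rw [hB]; simp only [Matrix.mul_assoc]
      rw [h1, h2, ← hBG.eq, ← Matrix.mul_assoc (B ^ k), ← pow_succ, pow_succ']
  refine ⟨A * B ^ k * G, hX, fun Y hY => hX.unique hY, ?_, fun i j => ?_⟩
  · rw [principalMinorSum_eq hM]
    exact fun h => hq0 (Quaternion.coe_injective (by rw [h, Quaternion.coe_zero]))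
  · have hne : ((minorSum q (B ^ (k + 2)) : ℝ) : ℍ[ℝ]) ≠ 0 :=
      fun h => hq0 (Quaternion.coe_injective (by rw [h, Quaternion.coe_zero]))
    rw [principalMinorSum_eq hM, rowReplacedMinorSum_eq hM, hrow, Quaternion.coe_commutes,
      mul_div_cancel_right₀ _ hne, Matrix.mul_apply]
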